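/- **Global vertical Poincaré inequality.** Let $B$ be a smooth surface, $D\subset B$ a finite set, $B_{\rm reg}=B\setminus D$, and let $B_0\subset B$ be open with compact closure contained in $B_{\rm reg}$, carrying a smooth Riemannian metric $g_B$ with Riemannian measure $\mu_B$. Let $t_0>0$. For every $t\in(0,t_0]$ let $(X_t,g(t))$ be a smooth Riemannian $4$-manifold, $\Pi_t:X_t\to B_{\rm reg}$ a smooth surjective submersion with fibres $F_{b,t}=\Pi_t^{-1}(b)$, $X_{t,0}=\Pi_t^{-1}(B_0)$, and $\mu_t$ the Riemannian measure of $g(t)$ on $X_{t,0}$. Suppose that $X_{t,0}$ carries a smooth product reference metric $g_t^\Pi=g_B\oplus g_{F,t}$, i.e. a Riemannian metric which is $\Pi_t^*g_B$ on the $g_t^\Pi$-orthogonal complement of $\ker d\Pi_t$ and whose restriction $g_{F,t}$ to $\ker d\Pi_t$ makes every fibre $F_{b,t}$, $b\in B_0$, a flat $2$-torus (isometric to some $\mathbb R^2/\Lambda_{b,t}$ with $\Lambda_{b,t}$ a lattice). Let $\vartheta_{b,t}$ be the Haar probability measure of the flat torus $F_{b,t}$, and $\lambda_1(F_{b,t},g_{F,t})$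 the first nonzero eigenvalue of its nonnegative Laplacian. Let $s,\varepsilon$ be functions with $s(t)>0$ and $\varepsilon_t\ge0$ on $(0,t_0]$ and $s(t)\to0$, $\varepsilon_t\to 0$ as $t\downarrow0$. Assume, with constants $c_{\rm gap}>0$ and $C_1$ independent of $t$: 1. (semi-flat control) $|g(t)-g_t^\Pi|_{g_t^\Pi}\le\varepsilon_t$ pointwise on $X_{t,0}$ (operator norm of bilinear forms) for all $t\in(0,t_0]$; 2. (vertical spectral gap) $\lambda_1(F_{b,t},g_{F,t})\ge c_{\rm gap}\,s(t)^{-2}$ for all $b\in B_0$, $t\in(0,t_0]$; 3. (normalized disintegration) for each $t\in(0,t_0]$ there are given measurable $A_t:B_0\to(0,\infty)$ and $\rho_t:X_{t,0}\to(0,\infty)$ with $\int_{F_{b,t}}\rho_t\,d\vartheta_{b,t}=1$ for all $b\in B_0$, such that for every measurable $f:X_{t,0}\to[0,\infty]$ the inner integral below is $\mu_B$-measurable in $b$ and $$\int_{X_{t,0}} f\,d\mu_t=\int_{B_0}A_t(b)\Big(\int_{F_{b,t}}f\,\rho_t\,d\vartheta_{b,t}\Big)d\mu_B(b);$$ 4.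 $\|\rho_t-1\|_{L^\infty(X_{t,0},\mu_t)}\le C_1\varepsilon_t$ for all $t\in(0,t_0]$. Put $(I_tv)(x)=A_t(\Pi_tx)^{-1/2}v(\Pi_tx)$, $(P_tu)(b)=A_t(b)^{1/2}\int_{F_{b,t}}u\,\rho_t\,d\vartheta_{b,t}$, and $(\Pi_t^{\rm fc})^\perp u=u-I_tP_tu$. Let $H^1(X_{t,0})$ be the Sobolev space of $(X_{t,0},g(t))$ (the closure of the smooth functions of finite norm in the $H^1$ norm), and for $u$ in it let $\nabla_Fu$ be the vertical gradient, i.e. the $g_{F,t}$-gradient of $u$ along the fibres. Then there are constants $C,c>0$ and $t_1\in(0,t_0]$ such that for all $t\in(0,t_1]$ and all $u\in H^1(X_{t,0})$ one has $(\Pi_t^{\rm fc})^\perp u\in L^2(\mu_t)$, $|\nabla_Fu|_{g_{F,t}}\in L^2(\mu_t)$, $$\|(\Pi_t^{\rm fc})^\perp u\|_{L^2(\mu_t)}^2\le C\,s(t)^2\int_{X_{t,0}}|\nabla_Fu|_{g_{F,t}}^2\,d\mu_t,$$ and, equivalently, $$\int_{X_{t,0}}|\nabla_Fu|_{g_{F,t}}^2\,d\mu_t\ge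 c\,s(t)^{-2}\|(\Pi_t^{\rm fc})^\perp u\|_{L^2(\mu_t)}^2 .$$ If $C_1\varepsilon_t\le\frac12$ for all $t\in(0,t_0]$, one can take $t_1=t_0$. -/

import Mathlib

open MeasureTheory Set Filter Topology Bundle
open scoped Manifold ContDiff ENNReal Laplacian

noncomputable section

namespace TorusCollapse

/-- A smooth Riemannian metric on the subset `U` (in practice open) of a smooth `n`-manifold `M`. -/
structure RiemMetricOn (n : ℕ) (M : Type*) [TopologicalSpace M]
    [ChartedSpace (EuclideanSpace ℝ (Fin n)) M]
    [IsManifold 𝓘(ℝ, EuclideanSpace ℝ (Fin n)) ∞ M] (U : Set M) where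
  inner : ∀ x : M, TangentSpace 𝓘(ℝ, EuclideanSpace ℝ (Fin n)) x →L[ℝ]
    TangentSpace 𝓘(ℝ, EuclideanSpace ℝ (Fin n)) x →L[ℝ] ℝ
  symm : ∀ x ∈ U, ∀ v w, inner x v w = inner x w v
  pos : ∀ x ∈ U, ∀ v, v ≠ 0 → 0 < inner x v v
  smooth : ContMDiffOn 𝓘(ℝ, EuclideanSpace ℝ (Fin n))
    (𝓘(ℝ, EuclideanSpace ℝ (Fin n)).prod
      𝓘(ℝ, EuclideanSpace ℝ (Fin n) →L[ℝ] EuclideanSpace ℝ (Fin n) →L[ℝ] ℝ)) ∞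
    (fun x ↦ TotalSpace.mk'
      (EuclideanSpace ℝ (Fin n) →L[ℝ] EuclideanSpace ℝ (Fin n) →L[ℝ] ℝ)
      (E := fun x : M ↦ TangentSpace 𝓘(ℝ, EuclideanSpace ℝ (Fin n)) x →L[ℝ]
        TangentSpace 𝓘(ℝ, EuclideanSpace ℝ (Fin n)) x →L[ℝ] ℝ) x (inner x)) U

section Metric

variable {n : ℕ} {M : Type*} [TopologicalSpace M] [ChartedSpace (EuclideanSpace ℝ (Fin n)) M]
  [IsManifold 𝓘(ℝ, EuclideanSpace ℝ (Fin n)) ∞ M] {U : Set M}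

/-- The matrix `g_{ij}` at the point with coordinates `y` in the preferred chart around `x₀`. -/
def RiemMetricOn.gram (g : RiemMetricOn n M U) (x₀ : M) (y : EuclideanSpace ℝ (Fin n)) :
    Matrix (Fin n) (Fin n) ℝ :=
  Matrix.of fun i j ↦
    let ψ := (chartAt (EuclideanSpace ℝ (Fin n)) x₀).symm
    let dψ := mfderiv 𝓘(ℝ, EuclideanSpace ℝ (Fin n)) 𝓘(ℝ, EuclideanSpace ℝ (Fin n)) ψ y
    g.inner (ψ y) (dψ (EuclideanSpace.single i (1 : ℝ))) (dψ (EuclideanSpace.single j (1 : ℝ)))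

/-- The measure `√(det g_{ij}) dy` of the preferred chart around `x₀`, transported to `M`
(and restricted to `U`). -/
def RiemMetricOn.chartMeasure [MeasurableSpace M] (g : RiemMetricOn n M U) (x₀ : M) : Measure M :=
  let ψ := (chartAt (EuclideanSpace ℝ (Fin n)) x₀).symm
  (((volume : Measure (EuclideanSpace ℝ (Fin n))).restrict (ψ.source ∩ ψ ⁻¹' U)).withDensity
    fun y ↦ ENNReal.ofReal (Real.sqrt (g.gram x₀ y).det)).map ψ

/-- The Riemannian measure of `g` on `U`. The chart measures agree on overlaps, so on a second
countable manifold their supremum is the measure glued from them: it restricts to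
`√(det g_{ij}) dy` in every chart. -/
def RiemMetricOn.measure [MeasurableSpace M] (g : RiemMetricOn n M U) : Measure M :=
  ⨆ x₀ : M, g.chartMeasure x₀

/-- The `g`-dual norm of the restriction of the covector `β` to the set `W` of tangent vectors
(a linear subspace). For `W = T_x M` it is the length of the gradient that corresponds to `β`;
for the vertical space it is the length of the vertical gradient. -/
def RiemMetricOn.dualNorm (g : RiemMetricOn n M U) (x : M)
    (W : Set (TangentSpace 𝓘(ℝ, EuclideanSpace ℝ (Fin n)) x))
    (β : TangentSpace 𝓘(ℝ, EuclideanSpace ℝ (Fin n)) x →L[ℝ] ℝ) : ℝ :=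
  sSup {r : ℝ | ∃ v ∈ W, g.inner x v v ≤ 1 ∧ r = |β v|}

/-- The differential of a real function, as a covector field. -/
def differential (φ : M → ℝ) (x : M) :
    TangentSpace 𝓘(ℝ, EuclideanSpace ℝ (Fin n)) x →L[ℝ] ℝ :=
  mfderiv 𝓘(ℝ, EuclideanSpace ℝ (Fin n)) 𝓘(ℝ, ℝ) φ x

/-- `u` belongs to the Sobolev space `H¹(V, g)` of the open set `V`, with differential `α`:
`(u, α)` is the limit in `L²(V) × L²(V; T^*)` of pairs `(φ, dφ)` with `φ` smooth on `V`. -/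
structure RiemMetricOn.IsH1 [MeasurableSpace M] (g : RiemMetricOn n M U) (V : Set M)
    (u : M → ℝ) (α : ∀ x : M, TangentSpace 𝓘(ℝ, EuclideanSpace ℝ (Fin n)) x →L[ℝ] ℝ) :
    Prop where
  memLp : MemLp u 2 (g.measure.restrict V)
  memLp_differential :
    MemLp (fun x ↦ g.dualNorm x univ (α x)) 2 (g.measure.restrict V)
  approx : ∃ φ : ℕ → M → ℝ,
    (∀ k, ContMDiffOn 𝓘(ℝ, EuclideanSpace ℝ (Fin n)) 𝓘(ℝ, ℝ) ∞ (φ k) V) ∧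
    (∀ k, MemLp (fun x ↦ φ k x - u x) 2 (g.measure.restrict V)) ∧
    (∀ k, MemLp (fun x ↦ g.dualNorm x univ (differential (φ k) x - α x)) 2
      (g.measure.restrict V)) ∧
    Tendsto (fun k ↦ eLpNorm (fun x ↦ φ k x - u x) 2 (g.measure.restrict V)) atTop (𝓝 0) ∧
    Tendsto (fun k ↦ eLpNorm (fun x ↦ g.dualNorm x univ (differential (φ k) x - α x)) 2
      (g.measure.restrict V)) atTop (𝓝 0)

end Metric

/-- A Riemannian 4-manifold `(X, g)` with a smooth surjective submersion onto `Breg`, together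
with, over `B₀`, a product reference metric `gRef = g_B ⊕ g_F` for which the fibres are flat
2-tori. The vertical space is `ker dΠ`, the horizontal space is its `gRef`-orthogonal complement,
and `g_F` is the restriction of `gRef` to the vertical spaces. -/
structure TorusFibration {B : Type*} [TopologicalSpace B]
    [ChartedSpace (EuclideanSpace ℝ (Fin 2)) B]
    [IsManifold 𝓘(ℝ, EuclideanSpace ℝ (Fin 2)) ∞ B]
    (Breg B₀ : Set B) (gB : RiemMetricOn 2 B B₀)
    (X : Type*) [TopologicalSpace X] [ChartedSpace (EuclideanSpace ℝ (Fin 4)) X]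
    [IsManifold 𝓘(ℝ, EuclideanSpace ℝ (Fin 4)) ∞ X] where
  proj : X → B
  proj_smooth :
    ContMDiff 𝓘(ℝ, EuclideanSpace ℝ (Fin 4)) 𝓘(ℝ, EuclideanSpace ℝ (Fin 2)) ∞ proj
  proj_range : range proj = Breg
  proj_submersion : ∀ x : X, Function.Surjective
    (mfderiv 𝓘(ℝ, EuclideanSpace ℝ (Fin 4)) 𝓘(ℝ, EuclideanSpace ℝ (Fin 2)) proj x)
  /-- the Riemannian metric of the total space -/
  g : RiemMetricOn 4 X univ
  /-- the product reference metric over `B₀` -/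
  gRef : RiemMetricOn 4 X (proj ⁻¹' B₀)
  /-- on horizontal vectors `gRef` is the pull-back of `g_B` -/
  gRef_horizontal : ∀ x ∈ proj ⁻¹' B₀, ∀ w : TangentSpace 𝓘(ℝ, EuclideanSpace ℝ (Fin 4)) x,
    (∀ v, mfderiv 𝓘(ℝ, EuclideanSpace ℝ (Fin 4)) 𝓘(ℝ, EuclideanSpace ℝ (Fin 2)) proj x v = 0 →
      gRef.inner x w v = 0) →
    gRef.inner x w w = gB.inner (proj x)
      (mfderiv 𝓘(ℝ, EuclideanSpace ℝ (Fin 4)) 𝓘(ℝ, EuclideanSpace ℝ (Fin 2)) proj x w)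
      (mfderiv 𝓘(ℝ, EuclideanSpace ℝ (Fin 4)) 𝓘(ℝ, EuclideanSpace ℝ (Fin 2)) proj x w)
  /-- a basis of the period lattice `Λ_b` of the fibre over `b` -/
  period : B → Module.Basis (Fin 2) ℝ (EuclideanSpace ℝ (Fin 2))
  /-- a smooth map `ℝ² → X` that induces an isometry of the flat torus `ℝ² / Λ_b` onto
  the fibre `(F_b, g_F)` -/
  unif : B → EuclideanSpace ℝ (Fin 2) → X
  unif_smooth : ∀ b ∈ B₀,
    ContMDiff 𝓘(ℝ, EuclideanSpace ℝ (Fin 2)) 𝓘(ℝ, EuclideanSpace ℝ (Fin 4)) ∞ (unif b)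
  unif_range : ∀ b ∈ B₀, range (unif b) = proj ⁻¹' {b}
  unif_eq_iff : ∀ b ∈ B₀, ∀ y z,
    unif b y = unif b z ↔ y - z ∈ Submodule.span ℤ (range (period b))
  unif_isometry : ∀ b ∈ B₀, ∀ y v w : EuclideanSpace ℝ (Fin 2),
    gRef.inner (unif b y)
      (mfderiv 𝓘(ℝ, EuclideanSpace ℝ (Fin 2)) 𝓘(ℝ, EuclideanSpace ℝ (Fin 4)) (unif b) y v)
      (mfderiv 𝓘(ℝ, EuclideanSpace ℝ (Fin 2)) 𝓘(ℝ, EuclideanSpace ℝ (Fin 4)) (unif b) y w) =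
    inner ℝ v w

namespace TorusFibration

variable {B : Type*} [TopologicalSpace B] [ChartedSpace (EuclideanSpace ℝ (Fin 2)) B]
  [IsManifold 𝓘(ℝ, EuclideanSpace ℝ (Fin 2)) ∞ B]
  {Breg B₀ : Set B} {gB : RiemMetricOn 2 B B₀}
  {X : Type*} [TopologicalSpace X] [ChartedSpace (EuclideanSpace ℝ (Fin 4)) X]
  [IsManifold 𝓘(ℝ, EuclideanSpace ℝ (Fin 4)) ∞ X]

/-- The part `X₀` of the total space over `B₀`. -/
def total (F : TorusFibration Breg B₀ gB X) : Set X := F.proj ⁻¹' B₀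

/-- The Riemannian measure of `g` on `X₀`. -/
def mu [MeasurableSpace X] (F : TorusFibration Breg B₀ gB X) : Measure X :=
  F.g.measure.restrict F.total

/-- The Haar probability measure of the flat torus over `b`: the image of normalized Lebesgue
measure on a fundamental parallelogram of the period lattice. -/
def haar [MeasurableSpace X] (F : TorusFibration Breg B₀ gB X) (b : B) : Measure X :=
  (ProbabilityTheory.cond volume (ZSpan.fundamentalDomain (F.period b))).map (F.unif b)

/-- `l` is an eigenvalue of the nonnegative Laplacian `-Δ` of the flat torus `ℝ² / Λ_b`. -/
def IsFiberEigenvalue (F : TorusFibration Breg B₀ gB X) (b : B) (l : ℝ) : Prop :=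
  ∃ f : EuclideanSpace ℝ (Fin 2) → ℝ, ContDiff ℝ ∞ f ∧
    (∀ p ∈ Submodule.span ℤ (range (F.period b)), ∀ y, f (y + p) = f y) ∧
    (∃ y, f y ≠ 0) ∧ ∀ y, -(Δ f y) = l * f y

/-- `λ₁` of the fibre over `b`: the first nonzero eigenvalue. -/
def lambda1 (F : TorusFibration Breg B₀ gB X) (b : B) : ℝ :=
  sInf {l : ℝ | l ≠ 0 ∧ F.IsFiberEigenvalue b l}

/-- The length `|∇_F u|_{g_F}` at `x` of the vertical gradient of a function with differential
`α` at `x`. -/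
def vertNorm (F : TorusFibration Breg B₀ gB X) (x : X)
    (α : TangentSpace 𝓘(ℝ, EuclideanSpace ℝ (Fin 4)) x →L[ℝ] ℝ) : ℝ :=
  F.gRef.dualNorm x
    {v | mfderiv 𝓘(ℝ, EuclideanSpace ℝ (Fin 4)) 𝓘(ℝ, EuclideanSpace ℝ (Fin 2)) F.proj x v = 0} α

/-- The `C⁰` part of semi-flat control: `|g - gRef|_{gRef} ≤ δ` at every point of `X₀`. -/
def SemiFlat (F : TorusFibration Breg B₀ gB X) (δ : ℝ) : Prop :=
  ∀ x ∈ F.total, ∀ v w : TangentSpace 𝓘(ℝ, EuclideanSpace ℝ (Fin 4)) x,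
    |F.g.inner x v w - F.gRef.inner x v w| ≤
      δ * (Real.sqrt (F.gRef.inner x v v) * Real.sqrt (F.gRef.inner x w w))

/-- Normalized disintegration `dμ = A(b) ρ dϑ_b dμ_B(b)` on `X₀`, with `∫ ρ dϑ_b = 1`. -/
structure IsDisintegration [MeasurableSpace B] [MeasurableSpace X]
    (F : TorusFibration Breg B₀ gB X) (A : B → ℝ) (ρ : X → ℝ) : Prop where
  measurable_A : Measurable A
  measurable_ρ : Measurable ρ
  A_pos : ∀ b ∈ B₀, 0 < A b
  ρ_pos : ∀ x ∈ F.total, 0 < ρ x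
  normalized : ∀ b ∈ B₀, ∫ x, ρ x ∂F.haar b = 1
  aemeasurable : ∀ f : X → ℝ≥0∞, Measurable f →
    AEMeasurable (fun b ↦ ∫⁻ x, f x * ENNReal.ofReal (ρ x) ∂F.haar b) (gB.measure.restrict B₀)
  lintegral_eq : ∀ f : X → ℝ≥0∞, Measurable f →
    ∫⁻ x, f x ∂F.mu = ∫⁻ b in B₀, ENNReal.ofReal (A b) *
      ∫⁻ x, f x * ENNReal.ofReal (ρ x) ∂F.haar b ∂gB.measure

/-- The normalized lift `(I v)(x) = A(Π x)^{-1/2} v(Π x)`. -/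
def lift (F : TorusFibration Breg B₀ gB X) (A : B → ℝ) (v : B → ℝ) (x : X) : ℝ :=
  A (F.proj x) ^ (-(1 / 2) : ℝ) * v (F.proj x)

/-- The normalized fibre average `(P u)(b) = A(b)^{1/2} ∫ u ρ dϑ_b`. -/
def avg [MeasurableSpace X] (F : TorusFibration Breg B₀ gB X) (A : B → ℝ) (ρ : X → ℝ)
    (u : X → ℝ) (b : B) : ℝ :=
  A b ^ (1 / 2 : ℝ) * ∫ x, u x * ρ x ∂F.haar b

/-- The fibre-oscillatory part `u - I P u`. -/
def osc [MeasurableSpace X] (F : TorusFibration Breg B₀ gB X) (A : B → ℝ) (ρ : X → ℝ)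
    (u : X → ℝ) (x : X) : ℝ :=
  u x - F.lift A (F.avg A ρ u) x

end TorusFibration

end TorusCollapse

end

/-! The powers of `A` in the lift and in the average cancel, so on `F.total` the operator `osc`
subtracts from `u` its mean over each fibre for the probability measure `ρ ϑ_b`. Moving `A` into the
base measure turns the hypothesis into a disintegration of `F.mu` into probability measures on the
fibres, and the inequality becomes a fibrewise variance bound integrated over the base.

On one flat torus, for smooth `φ`, the bound is Parseval: the coefficient at `n = 0` of `φ` minus
its mean vanishes, and differentiation multiplies each other coefficient by a dual lattice vector.
The squared length of that vector, times `4π²`, is an eigenvalue with a cosine as eigenfunction,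
hence is at least `λ₁` (`lambda1_le_freq`, `poincare_of_freq_ge`). In flat coordinates the fibre
derivative is dominated by the vertical gradient (`sum_fderiv_sq_le`).

The weight costs a factor 3. The mean minimises the squared distance to constants, so the Haar mean
may replace the weighted one; then `ρ ≤ 3/2` on the left and `ρ ≥ 1/2` on the right give
`(3/2)/(1/2)`. A general `u` in `H¹` is a limit of smooth functions: `osc` is an `L²` contraction,
and semi-flatness makes the vertical gradient continuous in the full `g`-gradient, so the smooth
estimate survives with the same constant. -/

/-! ### Disintegrations into probability measures on fibres, and fibrewise variance -/

/-- The measure `μ` is the integral over `κ` of the probability measures `ν b`, each of which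
lives on the fibre of `p` over `b`. -/
structure FiberDisintegration {X B : Type*} [MeasurableSpace X] [MeasurableSpace B]
    (p : X → B) (μ : Measure X) (κ : Measure B) (ν : B → Measure X) : Prop where
  measurable_proj : Measurable p
  prob : ∀ᵐ b ∂κ, IsProbabilityMeasure (ν b)
  fiber : ∀ᵐ b ∂κ, ∀ᵐ x ∂ν b, p x = b
  aemeasurable : ∀ f : X → ℝ≥0∞, Measurable f → AEMeasurable (fun b ↦ ∫⁻ x, f x ∂ν b) κ
  lintegral_eq : ∀ f : X → ℝ≥0∞, Measurable f → ∫⁻ x, f x ∂μ = ∫⁻ b, ∫⁻ x, f x ∂ν b ∂κ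

namespace FiberDisintegration

variable {X B : Type*} [MeasurableSpace X] [MeasurableSpace B]
  {p : X → B} {μ : Measure X} {κ : Measure B} {ν : B → Measure X}

/-- The integral formula is given for measurable functions only. Passing null sets to almost every
fibre is what extends it to functions measurable up to a null set, such as elements of `L²`. -/
theorem ae_ae (h : FiberDisintegration p μ κ ν) {P : X → Prop} (hP : ∀ᵐ x ∂μ, P x) :
    ∀ᵐ b ∂κ, ∀ᵐ x ∂ν b, P x := by
  obtain ⟨s, hs, hsm, hs0⟩ := exists_measurable_superset_of_null (ae_iff.1 hP)
  have h1 := h.lintegral_eq (s.indicator 1) (measurable_one.indicator hsm)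
  rw [lintegral_indicator_one hsm, hs0, eq_comm,
    lintegral_eq_zero_iff' (h.aemeasurable _ (measurable_one.indicator hsm))] at h1
  filter_upwards [h1] with b hb
  rw [lintegral_indicator_one hsm] at hb
  exact ae_iff.2 (measure_mono_null hs hb)

theorem aemeasurable' (h : FiberDisintegration p μ κ ν) {f : X → ℝ≥0∞} (hf : AEMeasurable f μ) :
    AEMeasurable (fun b ↦ ∫⁻ x, f x ∂ν b) κ := by
  refine (h.aemeasurable _ hf.measurable_mk).congr ?_
  filter_upwards [h.ae_ae hf.ae_eq_mk] with b hb
  exact (lintegral_congr_ae hb).symm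

theorem lintegral_eq' (h : FiberDisintegration p μ κ ν) {f : X → ℝ≥0∞} (hf : AEMeasurable f μ) :
    ∫⁻ x, f x ∂μ = ∫⁻ b, ∫⁻ x, f x ∂ν b ∂κ := by
  rw [lintegral_congr_ae hf.ae_eq_mk, h.lintegral_eq _ hf.measurable_mk]
  refine lintegral_congr_ae ?_
  filter_upwards [h.ae_ae hf.ae_eq_mk] with b hb
  exact (lintegral_congr_ae hb).symm

/-- Fibre means are controlled only for almost every `b`; this lets such statements be pulled back
along `p` to almost every point of the total space. -/
theorem quasiMeasurePreserving (h : FiberDisintegration p μ κ ν) :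
    Measure.QuasiMeasurePreserving p μ κ := by
  refine ⟨h.measurable_proj, Measure.AbsolutelyContinuous.mk fun s hs hs0 ↦ ?_⟩
  have hm := h.measurable_proj hs
  rw [Measure.map_apply h.measurable_proj hs, ← lintegral_indicator_one hm,
    h.lintegral_eq _ (measurable_one.indicator hm)]
  rw [lintegral_eq_zero_iff' (h.aemeasurable _ (measurable_one.indicator hm))]
  have hs' : ∀ᵐ b ∂κ, b ∉ s := measure_eq_zero_iff_ae_notMem.1 hs0
  filter_upwards [hs', h.fiber] with b hb hf
  rw [lintegral_indicator_one hm, Pi.zero_apply, measure_eq_zero_iff_ae_notMem]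
  filter_upwards [hf] with x hx
  simpa [hx] using hb

theorem ae_memLp_two (h : FiberDisintegration p μ κ ν) {u : X → ℝ} (hu : MemLp u 2 μ) :
    ∀ᵐ b ∂κ, MemLp u 2 (ν b) := by
  have h1 : AEMeasurable (fun x ↦ ‖u x‖ₑ ^ 2) μ := hu.1.enorm.pow_const 2
  have h2 : ∫⁻ x, ‖u x‖ₑ ^ 2 ∂μ ≠ ⊤ := by
    have := hu.eLpNorm_lt_top
    rw [eLpNorm_lt_top_iff_lintegral_rpow_enorm_lt_top two_ne_zero ENNReal.ofNat_ne_top] at this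
    simpa using this.ne
  rw [h.lintegral_eq' h1] at h2
  filter_upwards [ae_lt_top' (h.aemeasurable' h1) h2, h.ae_ae hu.1.ae_eq_mk] with b hb hb'
  refine ⟨⟨hu.1.mk u, hu.1.stronglyMeasurable_mk, hb'⟩, ?_⟩
  rw [eLpNorm_lt_top_iff_lintegral_rpow_enorm_lt_top two_ne_zero ENNReal.ofNat_ne_top]
  simpa using hb

theorem aestronglyMeasurable_integral (h : FiberDisintegration p μ κ ν) {u : X → ℝ}
    (hu : MemLp u 2 μ) : AEStronglyMeasurable (fun b ↦ ∫ x, u x ∂ν b) κ := by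
  -- The disintegration only speaks of integrals of nonnegative functions, hence the split into
  -- positive and negative parts.
  have h1 := (h.aemeasurable' hu.1.aemeasurable.ennreal_ofReal).ennreal_toReal
  have h2 := (h.aemeasurable' hu.1.aemeasurable.neg.ennreal_ofReal).ennreal_toReal
  refine ((h1.sub h2).congr ?_).aestronglyMeasurable
  filter_upwards [h.ae_memLp_two hu, h.prob] with b hb hp
  exact (integral_eq_lintegral_pos_part_sub_lintegral_neg_part (hb.integrable one_le_two)).symm

theorem aestronglyMeasurable_sub_integral (h : FiberDisintegration p μ κ ν) {u : X → ℝ}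
    (hu : MemLp u 2 μ) : AEStronglyMeasurable (fun x ↦ u x - ∫ y, u y ∂ν (p x)) μ :=
  hu.1.sub ((h.aestronglyMeasurable_integral hu).comp_quasiMeasurePreserving
    h.quasiMeasurePreserving)

/-- A fibrewise bound on the variance integrates to a bound on the fibre-oscillatory part. -/
theorem eLpNorm_sub_integral_le (h : FiberDisintegration p μ κ ν) {u V : X → ℝ} {K : ℝ≥0∞}
    (hu : MemLp u 2 μ) (hV : AEMeasurable V μ)
    (hK : ∀ᵐ b ∂κ, ∫⁻ x, ‖u x - ∫ y, u y ∂ν b‖ₑ ^ 2 ∂ν b ≤ K ^ 2 * ∫⁻ x, ‖V x‖ₑ ^ 2 ∂ν b) :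
    eLpNorm (fun x ↦ u x - ∫ y, u y ∂ν (p x)) 2 μ ≤ K * eLpNorm V 2 μ := by
  have key : ∫⁻ x, ‖u x - ∫ y, u y ∂ν (p x)‖ₑ ^ 2 ∂μ ≤ K ^ 2 * ∫⁻ x, ‖V x‖ₑ ^ 2 ∂μ := by
    have hm := h.aemeasurable' (hV.enorm.pow_const 2)
    rw [h.lintegral_eq' ((h.aestronglyMeasurable_sub_integral hu).enorm.pow_const 2),
      h.lintegral_eq' (hV.enorm.pow_const 2), ← lintegral_const_mul'' _ hm]
    refine lintegral_mono_ae ?_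
    filter_upwards [hK, h.fiber] with b hb hf
    refine le_trans (lintegral_mono_ae ?_) hb
    filter_upwards [hf] with x hx
    rw [hx]
  have e : ∀ w : X → ℝ, eLpNorm w 2 μ = (∫⁻ x, ‖w x‖ₑ ^ 2 ∂μ) ^ (1 / 2 : ℝ) := fun w ↦ by
    rw [eLpNorm_eq_lintegral_rpow_enorm_toReal two_ne_zero ENNReal.ofNat_ne_top]
    simp
  rw [e, e]
  refine (ENNReal.rpow_le_rpow key (by norm_num)).trans_eq ?_
  rw [ENNReal.mul_rpow_of_nonneg _ _ (by norm_num), ← ENNReal.rpow_natCast, ← ENNReal.rpow_mul]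
  norm_num

/-- The integral of `(u - c)²` is a quadratic polynomial in `c`, minimal at the mean. With `a` the
Haar mean this compares weighted and unweighted variances; with `a = 0` it gives the contraction
property. -/
theorem lintegral_sub_integral_sq_le {α : Type*} [MeasurableSpace α] {P : Measure α}
    [IsProbabilityMeasure P] {u : α → ℝ} (hu : MemLp u 2 P) (a : ℝ) :
    ∫⁻ x, ‖u x - ∫ y, u y ∂P‖ₑ ^ 2 ∂P ≤ ∫⁻ x, ‖u x - a‖ₑ ^ 2 ∂P := by
  have hi := hu.integrable one_le_two
  have e : ∀ c : ℝ, ∫⁻ x, ‖u x - c‖ₑ ^ 2 ∂P = ENNReal.ofReal (∫ x, (u x - c) ^ 2 ∂P) := fun c ↦ by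
    have : MemLp (fun x ↦ u x - c) 2 P := hu.sub (memLp_const c)
    rw [ofReal_integral_eq_lintegral_ofReal this.integrable_sq (ae_of_all _ fun _ ↦ sq_nonneg _)]
    refine lintegral_congr fun x ↦ ?_
    rw [← sq_abs, ENNReal.ofReal_pow (abs_nonneg _), Real.enorm_eq_ofReal_abs]
  have q : ∀ c : ℝ, ∫ x, (u x - c) ^ 2 ∂P = ∫ x, u x ^ 2 ∂P - 2 * c * ∫ x, u x ∂P + c ^ 2 := by
    intro c
    have : ∀ x, (u x - c) ^ 2 = u x ^ 2 - 2 * c * u x + c ^ 2 := fun x ↦ by ring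
    simp_rw [this]
    have hi' : Integrable (fun x ↦ 2 * c * u x) P := hi.const_mul _
    have hi'' : Integrable (fun x ↦ u x ^ 2 - 2 * c * u x) P := hu.integrable_sq.sub hi'
    rw [integral_add hi'' (integrable_const _), integral_sub hu.integrable_sq hi',
      integral_const_mul]
    simp
  rw [e, e, q, q]
  refine ENNReal.ofReal_le_ofReal ?_
  nlinarith [sq_nonneg (∫ x, u x ∂P - a)]

theorem eLpNorm_sub_integral_le_self (h : FiberDisintegration p μ κ ν) {u : X → ℝ}
    (hu : MemLp u 2 μ) :
    eLpNorm (fun x ↦ u x - ∫ y, u y ∂ν (p x)) 2 μ ≤ eLpNorm u 2 μ := by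
  have := h.eLpNorm_sub_integral_le (V := u) (K := 1) hu hu.1.aemeasurable ?_
  · simpa using this
  filter_upwards [h.ae_memLp_two hu, h.prob] with b hb hp
  simpa using lintegral_sub_integral_sq_le hb 0

end FiberDisintegration

/-! ### Periodic functions as functions on the standard torus, and Parseval -/

namespace ZSpan

attribute [local instance] instMeasureSpaceUnitAddCircle instIsAddHaarMeasureUnitAddCircleVolume
  instIsProbabilityMeasureUnitAddCircleVolume

variable {ι : Type*} {E : Type*} [NormedAddCommGroup E] [InnerProductSpace ℝ E] (b : Module.Basis ι ℝ E)

/-- The projection of `E` onto the standard torus given by the coordinates with respect to `b`. -/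
noncomputable def toTorus (y : E) : UnitAddTorus ι := fun i ↦ (b.repr y i : UnitAddCircle)

theorem toTorus_add (y z : E) : toTorus b (y + z) = toTorus b y + toTorus b z := by
  ext i; simp [toTorus]

theorem toTorus_eq_iff {y z : E} :
    toTorus b y = toTorus b z ↔ y - z ∈ Submodule.span ℤ (range b) := by
  rw [b.mem_span_iff_repr_mem ℤ, funext_iff]
  refine forall_congr' fun i ↦ ?_
  rw [toTorus, toTorus, ← sub_eq_zero, ← AddCircle.coe_sub, AddCircle.coe_eq_zero_iff]
  simp

variable [Fintype ι] [FiniteDimensional ℝ E]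

theorem toTorus_eq_comp :
    toTorus b = (Pi.map fun _ ↦ ((↑) : ℝ → UnitAddCircle)) ∘ b.equivFun.toContinuousLinearEquiv :=
  rfl

theorem isQuotientMap_toTorus : IsQuotientMap (toTorus b) := by
  rw [toTorus_eq_comp]
  refine (IsOpenQuotientMap.piMap fun _ ↦ ?_).isQuotientMap.comp
    b.equivFun.toContinuousLinearEquiv.toHomeomorph.isQuotientMap
  exact QuotientAddGroup.isOpenQuotientMap_mk

theorem exists_continuousMap_torus {f : E → ℂ} (hf : Continuous f)
    (hp : ∀ p ∈ Submodule.span ℤ (range b), ∀ y, f (y + p) = f y) :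
    ∃ F : C(UnitAddTorus ι, ℂ), ∀ y, F (toTorus b y) = f y := by
  have hq := isQuotientMap_toTorus b
  have hfac : Function.FactorsThrough f (toTorus b) := fun y z hyz ↦ by
    rw [← hp _ ((toTorus_eq_iff b).1 hyz) z, add_sub_cancel]
  let q : C(E, UnitAddTorus ι) := ⟨toTorus b, hq.continuous⟩
  have hq' : IsQuotientMap q := hq
  refine ⟨hq'.lift ⟨f, hf⟩ hfac, fun y ↦ ?_⟩
  exact congrFun (congrArg DFunLike.coe (hq'.lift_comp ⟨f, hf⟩ hfac)) y

variable [MeasurableSpace E] [BorelSpace E]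

/-- The normalized Lebesgue measure on the fundamental parallelepiped of `b`. -/
noncomputable abbrev prob : Measure E := ProbabilityTheory.cond volume (fundamentalDomain b)

instance : IsProbabilityMeasure (prob b) := by
  refine ProbabilityTheory.cond_isProbabilityMeasure_of_finite
    (measure_fundamentalDomain_ne_zero b) ?_
  exact (fundamentalDomain_isBounded b).measure_lt_top.ne

/-- In lattice coordinates Lebesgue measure becomes a Haar measure on `ι → ℝ`, so a multiple `c` of
the standard one, and the fundamental domain becomes the unit cube. The constant need not be
computed: both sides have total mass 1. -/
theorem measurePreserving_toTorus : MeasurePreserving (toTorus b) (prob b) volume := by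
  have hm : Measurable (toTorus b) := (isQuotientMap_toTorus b).continuous.measurable
  refine ⟨hm, ?_⟩
  let L := b.equivFun.toContinuousLinearEquiv
  have hL : Measurable L := L.continuous.measurable
  let Q : (ι → ℝ) → UnitAddTorus ι := Pi.map fun _ ↦ ((↑) : ℝ → UnitAddCircle)
  have hQ : MeasurePreserving Q (volume.restrict (univ.pi fun _ ↦ Ioc (0 : ℝ) 1))
      (volume : Measure (UnitAddTorus ι)) := by
    have := measurePreserving_pi _ _ fun _ : ι ↦ AddCircle.measurePreserving_mk 1 (0 : ℝ)
    rw [← Measure.restrict_pi_pi] at this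
    convert! this using 1
    · simp [volume]
    · simp [volume, AddCircle.haarAddCircle]
  have : (Measure.map L (volume : Measure E)).IsAddHaarMeasure := L.isAddHaarMeasure_map _
  obtain ⟨c, hc⟩ : ∃ c : ℝ≥0∞, Measure.map L (volume : Measure E) = c • volume :=
    ⟨_, Measure.isAddLeftInvariant_eq_smul (Measure.map L (volume : Measure E))
    (volume : Measure (ι → ℝ))⟩
  have hFD : fundamentalDomain b = L ⁻¹' (univ.pi fun _ ↦ Ico (0 : ℝ) 1) := by
    ext y; simp only [mem_fundamentalDomain, mem_preimage, mem_univ_pi]; rfl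
  have hae : (univ.pi fun _ : ι ↦ Ico (0 : ℝ) 1) =ᵐ[volume] univ.pi fun _ ↦ Ioc (0 : ℝ) 1 :=
    Measure.univ_pi_Ico_ae_eq_Icc.trans Measure.univ_pi_Ioc_ae_eq_Icc.symm
  have key : Measure.map (toTorus b) (prob b)
      = ((volume (fundamentalDomain b))⁻¹ * c) • (volume : Measure (UnitAddTorus ι)) := by
    have e : toTorus b = Q ∘ L := rfl
    change Measure.map (toTorus b)
      ((volume (fundamentalDomain b))⁻¹ • volume.restrict (fundamentalDomain b)) = _
    rw [Measure.map_smul, e, ← Measure.map_map hQ.measurable hL, hFD,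
      ← Measure.restrict_map hL (MeasurableSet.univ_pi fun _ ↦ measurableSet_Ico), hc,
      Measure.restrict_smul, Measure.map_smul, Measure.restrict_congr_set hae, hQ.map_eq, smul_smul]
  have h1 := congrArg (fun m : Measure (UnitAddTorus ι) ↦ m univ) key
  have := Measure.isProbabilityMeasure_map (μ := prob b) hm.aemeasurable
  simp only [measure_univ, Measure.smul_apply, smul_eq_mul, mul_one] at h1
  rw [key, ← h1, one_smul]

/-- The Fourier coefficients of a function periodic under the lattice spanned by `b`. -/
noncomputable def coeff (f : E → ℂ) (n : ι → ℤ) : ℂ :=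
  ∫ y, UnitAddTorus.mFourier (-n) (toTorus b y) * f y ∂prob b

theorem integral_comp_toTorus (F : C(UnitAddTorus ι, ℂ)) :
    ∫ y, F (toTorus b y) ∂prob b = ∫ x, F x := by
  rw [← (measurePreserving_toTorus b).map_eq, integral_map
    (measurePreserving_toTorus b).aemeasurable F.continuous.aestronglyMeasurable]

theorem hasSum_sq_coeff {f : E → ℂ} (hf : Continuous f)
    (hp : ∀ p ∈ Submodule.span ℤ (range b), ∀ y, f (y + p) = f y) :
    HasSum (fun n ↦ ‖coeff b f n‖ ^ 2) (∫ y, ‖f y‖ ^ 2 ∂prob b) := by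
  obtain ⟨F, hF⟩ := exists_continuousMap_torus b hf hp
  have h := UnitAddTorus.hasSum_sq_mFourierCoeff (F.toLp 2 volume ℂ)
  have hm := measurePreserving_toTorus b
  convert! h using 1
  · ext n
    rw [UnitAddTorus.mFourierCoeff_toLp, UnitAddTorus.mFourierCoeff, ← hm.map_eq,
      integral_map hm.aemeasurable (by fun_prop)]
    simp only [hF, coeff, smul_eq_mul]
  · have : ∫ t, ‖(F.toLp 2 volume ℂ : UnitAddTorus ι → ℂ) t‖ ^ 2 = ∫ t, ‖F t‖ ^ 2 := by
      refine integral_congr_ae ?_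
      filter_upwards [F.coeFn_toLp (p := 2) (𝕜 := ℂ) volume] with x hx
      rw [hx]
    rw [this, ← hm.map_eq, integral_map hm.aemeasurable (by fun_prop)]
    simp only [hF]

theorem integral_add_right_prob {f : E → ℂ} (hf : Continuous f)
    (hp : ∀ p ∈ Submodule.span ℤ (range b), ∀ y, f (y + p) = f y) (v : E) :
    ∫ y, f (y + v) ∂prob b = ∫ y, f y ∂prob b := by
  obtain ⟨F, hF⟩ := exists_continuousMap_torus b hf hp
  let G : C(UnitAddTorus ι, ℂ) := ⟨fun x ↦ F (x + toTorus b v), by fun_prop⟩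
  have h1 := integral_comp_toTorus b G
  have h2 := integral_comp_toTorus b F
  simp only [hF] at h2
  simp only [G, ContinuousMap.coe_mk, ← toTorus_add, hF] at h1
  rw [h1, h2]
  exact integral_add_right_eq_self (fun x ↦ F x) _

end ZSpan

/-! ### Fourier coefficients of derivatives and the Poincaré inequality on a flat torus -/

namespace ZSpan

attribute [local instance] instMeasureSpaceUnitAddCircle instIsAddHaarMeasureUnitAddCircleVolume
  instIsProbabilityMeasureUnitAddCircleVolume

theorem _root_.UnitAddTorus.mFourier_apply_add {ι : Type*} [Fintype ι] (n : ι → ℤ)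
    (x y : UnitAddTorus ι) :
    UnitAddTorus.mFourier n (x + y) = UnitAddTorus.mFourier n x * UnitAddTorus.mFourier n y := by
  simp [UnitAddTorus.mFourier, fourier_apply, AddCircle.toCircle_add, smul_add,
    Finset.prod_mul_distrib]

variable {ι : Type*} [Fintype ι] {E : Type*} [NormedAddCommGroup E] [InnerProductSpace ℝ E]
  [FiniteDimensional ℝ E] (b : Module.Basis ι ℝ E)

/-- The element of the dual lattice with coordinates `n`, as a linear form. -/
noncomputable def freq (n : ι → ℤ) : E →L[ℝ] ℝ :=
  LinearMap.toContinuousLinearMap (∑ i, (n i : ℝ) • b.coord i)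

theorem freq_apply (n : ι → ℤ) (y : E) : freq b n y = ∑ i, (n i : ℝ) * b.repr y i := by
  simp [freq]

theorem freq_basis (n : ι → ℤ) (i : ι) : freq b n (b i) = n i := by
  classical
  simp [freq_apply, Finsupp.single_apply]

theorem mFourier_toTorus (n : ι → ℤ) (y : E) :
    UnitAddTorus.mFourier n (toTorus b y) = Complex.exp (2 * Real.pi * Complex.I * freq b n y) := by
  simp only [UnitAddTorus.mFourier, toTorus, ContinuousMap.coe_mk, fourier_coe_apply, freq_apply]
  rw [← Complex.exp_sum]
  congr 1
  push_cast
  rw [Finset.mul_sum]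
  exact Finset.sum_congr rfl fun i _ ↦ by ring

theorem exists_int_freq_eq (n : ι → ℤ) {p : E} (hp : p ∈ Submodule.span ℤ (range b)) :
    ∃ k : ℤ, freq b n p = k := by
  rw [b.mem_span_iff_repr_mem ℤ] at hp
  choose k hk using hp
  refine ⟨∑ i, n i * k i, ?_⟩
  rw [freq_apply]
  push_cast
  exact Finset.sum_congr rfl fun i _ ↦ by rw [← hk i]; simp

theorem exists_norm_le_of_periodic {f : E → ℂ} (hf : Continuous f)
    (hp : ∀ p ∈ Submodule.span ℤ (range b), ∀ y, f (y + p) = f y) : ∃ C, ∀ y, ‖f y‖ ≤ C := by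
  obtain ⟨F, hF⟩ := exists_continuousMap_torus b hf hp
  exact ⟨‖F‖, fun y ↦ hF y ▸ F.norm_coe_le_norm _⟩

omit [FiniteDimensional ℝ E] in
theorem periodic_fderiv {F : Type*} [NormedAddCommGroup F] [NormedSpace ℝ F] {f : E → F} {p : E}
    (hp : ∀ y, f (y + p) = f y) (y : E) : fderiv ℝ f (y + p) = fderiv ℝ f y := by
  rw [← fderiv_comp_add_right]
  exact congrArg (fun g ↦ fderiv ℝ g y) (funext hp)

variable [MeasurableSpace E] [BorelSpace E]

theorem coeff_translate {f : E → ℂ} (hf : Continuous f)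
    (hp : ∀ p ∈ Submodule.span ℤ (range b), ∀ y, f (y + p) = f y) (n : ι → ℤ) (v : E) :
    coeff b (fun y ↦ f (y + v)) n = UnitAddTorus.mFourier n (toTorus b v) * coeff b f n := by
  have hc := (isQuotientMap_toTorus b).continuous
  have h := integral_add_right_prob b
    (f := fun y ↦ UnitAddTorus.mFourier (-n) (toTorus b y) * f y) (by fun_prop)
    (fun p hpm y ↦ by
      rw [hp p hpm, (toTorus_eq_iff b (y := y + p) (z := y)).2 (by simpa using hpm)]) v
  rw [coeff, coeff, ← h, ← integral_const_mul]
  refine integral_congr_ae (ae_of_all _ fun y ↦ ?_)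
  have h1 : UnitAddTorus.mFourier n (toTorus b v) * UnitAddTorus.mFourier (-n) (toTorus b v) = 1 := by
    rw [← UnitAddTorus.mFourier_add]; simp [UnitAddTorus.mFourier_zero]
  simp only [toTorus_add, UnitAddTorus.mFourier_apply_add]
  linear_combination (-(UnitAddTorus.mFourier (-n) (toTorus b y)) * f (y + v)) * h1

/-- Instead of integrating by parts, the coefficient of the translate `f (· + h • v)` is
differentiated at `h = 0` in two ways: under the integral sign, and through `coeff_translate`, where
it is an exponential in `h` times a constant. -/
theorem coeff_fderiv {f : E → ℂ} (hf : ContDiff ℝ 1 f)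
    (hp : ∀ p ∈ Submodule.span ℤ (range b), ∀ y, f (y + p) = f y) (n : ι → ℤ) (v : E) :
    coeff b (fun y ↦ fderiv ℝ f y v) n
      = 2 * Real.pi * Complex.I * freq b n v * coeff b f n := by
  have hc := (isQuotientMap_toTorus b).continuous
  have hf0 := hf.continuous
  have hf' : Continuous fun y ↦ fderiv ℝ f y v :=
    (hf.continuous_fderiv one_ne_zero).clm_apply continuous_const
  have hp' : ∀ p ∈ Submodule.span ℤ (range b), ∀ y, fderiv ℝ f (y + p) v = fderiv ℝ f y v :=
    fun p hpm y ↦ by rw [periodic_fderiv (hp p hpm)]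
  obtain ⟨C, hC⟩ := exists_norm_le_of_periodic b hf' hp'
  obtain ⟨C0, hC0⟩ := exists_norm_le_of_periodic b hf0 hp
  have hχ : ∀ x, ‖UnitAddTorus.mFourier (-n) x‖ ≤ 1 := fun x ↦
    ((UnitAddTorus.mFourier (-n)).norm_coe_le_norm x).trans UnitAddTorus.mFourier_norm.le
  have key := (hasDerivAt_integral_of_dominated_loc_of_deriv_le (μ := prob b) (𝕜 := ℝ)
    (F := fun (h : ℝ) y ↦ UnitAddTorus.mFourier (-n) (toTorus b y) * f (y + h • v))
    (F' := fun (h : ℝ) y ↦ UnitAddTorus.mFourier (-n) (toTorus b y) * fderiv ℝ f (y + h • v) v)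
    (x₀ := 0) (s := univ) (bound := fun _ ↦ C) univ_mem
    (Eventually.of_forall fun h ↦ (by fun_prop : Continuous _).aestronglyMeasurable)
    ?_ ?_ ?_ (integrable_const _) ?_).2
  · have e : (fun h : ℝ ↦ ∫ y, UnitAddTorus.mFourier (-n) (toTorus b y) * f (y + h • v) ∂prob b)
        = fun h : ℝ ↦ Complex.exp (h * (2 * Real.pi * Complex.I * freq b n v)) * coeff b f n := by
      ext h
      have := coeff_translate b hf0 hp n (h • v)
      rw [mFourier_toTorus] at this
      rw [coeff] at this
      rw [this]
      congr 2
      simp only [map_smul, smul_eq_mul, Complex.ofReal_mul]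
      ring
    rw [e] at key
    have d : HasDerivAt
        (fun h : ℝ ↦ Complex.exp (h * (2 * Real.pi * Complex.I * freq b n v)) * coeff b f n)
        (2 * Real.pi * Complex.I * freq b n v * coeff b f n) 0 := by
      have := (((Complex.ofRealCLM.hasDerivAt (x := (0 : ℝ))).mul_const
        (2 * Real.pi * Complex.I * freq b n v)).cexp).mul_const (coeff b f n)
      simpa using this
    have := key.unique d
    simpa [coeff] using this
  · refine Integrable.of_bound (C := C0) (by fun_prop : Continuous _).aestronglyMeasurable
      (ae_of_all _ fun y ↦ ?_)
    rw [norm_mul]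
    exact (mul_le_mul (hχ _) (hC0 _) (norm_nonneg _) zero_le_one).trans_eq (one_mul _)
  · simp only [zero_smul, add_zero]
    exact (by fun_prop : Continuous _).aestronglyMeasurable
  · refine ae_of_all _ fun y h _ ↦ ?_
    rw [norm_mul]
    exact (mul_le_mul (hχ _) (hC _) (norm_nonneg _) zero_le_one).trans_eq (one_mul _)
  · refine ae_of_all _ fun y h _ ↦ ?_
    have h1 : HasDerivAt (fun h : ℝ ↦ y + h • v) v h := by
      simpa using ((hasDerivAt_id h).smul_const v).const_add y
    exact ((((hf.differentiable one_ne_zero) _).hasFDerivAt.comp_hasDerivAt h h1)).const_mul _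

/-- The Poincaré inequality on the flat torus `E / Λ`, in terms of the dual lattice. -/
theorem poincare_of_freq_ge {κ : Type*} [Fintype κ] (v : κ → E) {l : ℝ}
    (hl : ∀ n : ι → ℤ, n ≠ 0 → l ≤ 4 * Real.pi ^ 2 * ∑ j, freq b n (v j) ^ 2)
    {f : E → ℝ} (hf : ContDiff ℝ 1 f)
    (hp : ∀ p ∈ Submodule.span ℤ (range b), ∀ y, f (y + p) = f y) :
    l * ∫ y, (f y - ∫ z, f z ∂prob b) ^ 2 ∂prob b
      ≤ ∫ y, ∑ j, (fderiv ℝ f y (v j)) ^ 2 ∂prob b := by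
  set m := ∫ z, f z ∂prob b with hm
  let g : E → ℂ := fun y ↦ ((f y - m : ℝ) : ℂ)
  have hg : ContDiff ℝ 1 g := Complex.ofRealCLM.contDiff.comp (hf.sub contDiff_const)
  have hgp : ∀ p ∈ Submodule.span ℤ (range b), ∀ y, g (y + p) = g y :=
    fun p hpm y ↦ by simp only [g, hp p hpm]
  have hgd : ∀ y w, fderiv ℝ g y w = ((fderiv ℝ f y w : ℝ) : ℂ) := fun y w ↦ by
    have h1 : HasFDerivAt (fun y ↦ f y - m) (fderiv ℝ f y) y :=
      ((hf.differentiable one_ne_zero) y).hasFDerivAt.sub_const m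
    have h2 : HasFDerivAt g (Complex.ofRealCLM.comp (fderiv ℝ f y)) y :=
      Complex.ofRealCLM.hasFDerivAt.comp y h1
    rw [h2.fderiv]; rfl
  obtain ⟨C, hC⟩ := exists_norm_le_of_periodic b hg.continuous hgp
  have hfi : Integrable f (prob b) := by
    refine Integrable.of_bound (C := C + |m|) hf.continuous.aestronglyMeasurable
      (ae_of_all _ fun y ↦ ?_)
    have := hC y
    simp only [g, Complex.norm_real] at this
    calc ‖f y‖ = ‖(f y - m) + m‖ := by ring_nf
      _ ≤ _ := (norm_add_le _ _).trans (add_le_add this le_rfl)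
  have hc0 : coeff b g 0 = 0 := by
    have : coeff b g 0 = ∫ y, ((f y - m : ℝ) : ℂ) ∂prob b := by
      simp [coeff, g, UnitAddTorus.mFourier_zero]
    rw [this, integral_complex_ofReal, integral_sub hfi (integrable_const _)]
    simp [hm]
  have S0 := (hasSum_sq_coeff b hg.continuous hgp).mul_left l
  have hgc : ∀ j, Continuous fun y ↦ fderiv ℝ g y (v j) := fun j ↦
    (hg.continuous_fderiv one_ne_zero).clm_apply continuous_const
  have hgdp : ∀ j, ∀ p ∈ Submodule.span ℤ (range b), ∀ y,
      fderiv ℝ g (y + p) (v j) = fderiv ℝ g y (v j) :=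
    fun j p hpm y ↦ by rw [periodic_fderiv (hgp p hpm)]
  have S1 := hasSum_sum fun j (_ : j ∈ Finset.univ) ↦ hasSum_sq_coeff b (hgc j) (hgdp j)
  -- Parseval for `g` and for its directional derivatives reduces the claim to a comparison for each
  -- frequency `n`. At `n = 0` the left side vanishes because the mean was subtracted.
  have hle := hasSum_le (fun n ↦ ?_) S0 S1
  · have e0 : ∀ y, ‖g y‖ ^ 2 = (f y - m) ^ 2 := fun y ↦ by
      simp only [g, Complex.norm_real, Real.norm_eq_abs, sq_abs]
    have e1 : ∀ j y, ‖fderiv ℝ g y (v j)‖ ^ 2 = fderiv ℝ f y (v j) ^ 2 := fun j y ↦ by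
      simp [hgd, Complex.norm_real]
    simp only [e0, e1] at hle
    rw [integral_finsetSum]
    · exact hle
    intro j _
    obtain ⟨C', hC'⟩ := exists_norm_le_of_periodic b (hgc j) (hgdp j)
    simp only [← e1]
    refine Integrable.of_bound (C := C' ^ 2) ((hgc j).norm.pow 2).aestronglyMeasurable
      (ae_of_all _ fun y ↦ ?_)
    rw [norm_pow, norm_norm]
    exact pow_le_pow_left₀ (norm_nonneg _) (hC' y) 2
  · rcases eq_or_ne n 0 with rfl | hn
    · rw [hc0]; simp only [norm_zero]; norm_num; exact Finset.sum_nonneg fun _ _ ↦ sq_nonneg _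
    · have : ∀ j, ‖coeff b (fun y ↦ fderiv ℝ g y (v j)) n‖ ^ 2
          = 4 * Real.pi ^ 2 * freq b n (v j) ^ 2 * ‖coeff b g n‖ ^ 2 := fun j ↦ by
        rw [coeff_fderiv b hg hgp]
        simp only [norm_mul, mul_pow, Complex.norm_real, Complex.norm_I, Real.norm_eq_abs, sq_abs,
          Complex.norm_ofNat]
        ring
      simp only [this]
      rw [← Finset.sum_mul, ← Finset.mul_sum]
      exact mul_le_mul_of_nonneg_right (hl n hn) (sq_nonneg _)

omit [MeasurableSpace E] [BorelSpace E] in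
theorem laplacian_cos {κ : Type*} [Fintype κ] (v : OrthonormalBasis κ ℝ E) (L : E →L[ℝ] ℝ) (y : E) :
    Δ (fun y ↦ Real.cos (L y)) y = -((∑ j, L (v j) ^ 2) * Real.cos (L y)) := by
  have h1 : fderiv ℝ (fun y ↦ Real.cos (L y)) = fun y ↦ (-Real.sin (L y)) • L := by
    ext1 z
    exact (L.hasFDerivAt.cos).fderiv
  have h2 : fderiv ℝ (fun y ↦ (-Real.sin (L y)) • L) y
      = ((-Real.cos (L y)) • L).smulRight L := by
    have : HasFDerivAt (fun y ↦ -Real.sin (L y)) ((-Real.cos (L y)) • L) y := by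
      convert! (L.hasFDerivAt (x := y)).sin.neg using 1
      ext z
      simp
    exact (this.smul_const L).fderiv
  rw [InnerProductSpace.laplacian_eq_iteratedFDeriv_orthonormalBasis _ v]
  simp only [iteratedFDeriv_two_apply, h1, h2]
  simp [Finset.sum_mul, ← Finset.sum_neg_distrib]
  exact Finset.sum_congr rfl fun j _ ↦ by ring

end ZSpan

/-! ### Norms of linear forms on kernels, in families -/

section Linear

variable {E : Type*} [NormedAddCommGroup E] [NormedSpace ℝ E] [FiniteDimensional ℝ E]

omit [FiniteDimensional ℝ E] in
theorem mul_sq_norm_le_of_sphere (G : E →L[ℝ] E →L[ℝ] ℝ) {a : ℝ}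
    (hG : ∀ v ∈ Metric.sphere (0 : E) 1, a ≤ G v v) (v : E) : a * ‖v‖ ^ 2 ≤ G v v := by
  rcases eq_or_ne v 0 with rfl | hv
  · simp
  · have hn : ‖v‖ ≠ 0 := norm_ne_zero_iff.2 hv
    have h2 := hG (‖v‖⁻¹ • v) (by simp [norm_smul, hn])
    simp only [map_smul, _root_.smul_apply, smul_eq_mul] at h2
    calc a * ‖v‖ ^ 2 ≤ (‖v‖⁻¹ * (‖v‖⁻¹ * G v v)) * ‖v‖ ^ 2 := by gcongr
      _ = G v v := by field_simp

theorem exists_sphere_le_of_pos (G : E →L[ℝ] E →L[ℝ] ℝ) (hG : ∀ v, v ≠ 0 → 0 < G v v) :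
    ∃ a > 0, ∀ v ∈ Metric.sphere (0 : E) 1, a ≤ G v v := by
  rcases (Metric.sphere (0 : E) 1).eq_empty_or_nonempty with h | h
  · exact ⟨1, one_pos, by simp [h]⟩
  · obtain ⟨w, hw, hmin⟩ := (isCompact_sphere (0 : E) 1).exists_isMinOn h
      (f := fun v ↦ G v v) (G.continuous.clm_apply continuous_id).continuousOn
    have hw0 : w ≠ 0 := by
      rintro rfl; simp at hw
    exact ⟨G w w, hG w hw0, fun v hv ↦ hmin hv⟩

/-- Needed because `sSup` of an unbounded set is 0: without it the dual norm would not dominate its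
own candidates. -/
theorem bddAbove_abs_apply (G : E →L[ℝ] E →L[ℝ] ℝ) (hG : ∀ v, v ≠ 0 → 0 < G v v)
    (β : E →L[ℝ] ℝ) (W : Set E) : BddAbove {r : ℝ | ∃ v ∈ W, G v v ≤ 1 ∧ r = |β v|} := by
  obtain ⟨a, ha, h'⟩ := exists_sphere_le_of_pos G hG
  have h := mul_sq_norm_le_of_sphere G h'
  refine ⟨‖β‖ * Real.sqrt a⁻¹, ?_⟩
  rintro _ ⟨v, -, hv, rfl⟩
  refine (β.le_opNorm v).trans ?_
  gcongr
  refine Real.le_sqrt_of_sq_le ?_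
  rw [← one_div, le_div_iff₀ ha, mul_comm]
  exact (h v).trans hv

/-- Upper semicontinuity of the norm of a linear form on the kernel of a linear map. -/
theorem eventually_forall_ker_abs_lt {M F : Type*} [TopologicalSpace M] [NormedAddCommGroup F]
    [NormedSpace ℝ F] {x₀ : M} {G : M → E →L[ℝ] E →L[ℝ] ℝ} {P : M → E →L[ℝ] F}
    {Φ : M → E →L[ℝ] ℝ} (hG : ContinuousAt G x₀) (hP : ContinuousAt P x₀)
    (hΦ : ContinuousAt Φ x₀) (hpos : ∀ v, v ≠ 0 → 0 < G x₀ v v) {c : ℝ}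
    (hc : ∀ v, P x₀ v = 0 → G x₀ v v ≤ 1 → |Φ x₀ v| < c) :
    ∀ᶠ x in 𝓝 x₀, ∀ v, P x v = 0 → G x v v ≤ 1 → |Φ x v| < c := by
  obtain ⟨a, ha, h⟩ := exists_sphere_le_of_pos (G x₀) hpos
  have cG : ∀ v, ContinuousAt (fun z : M × E ↦ G z.1 z.2 z.2) (x₀, v) := fun v ↦
    ContinuousAt.clm_apply (ContinuousAt.clm_apply
      (ContinuousAt.comp hG continuousAt_fst) continuousAt_snd) continuousAt_snd
  -- Half the lower bound on the sphere persists near `x₀`, so admissible vectors stay in the fixed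
  -- compact ball of radius `√(2 / a)`.
  have h1 : ∀ᶠ x in 𝓝 x₀, ∀ v ∈ Metric.sphere (0 : E) 1, a / 2 ≤ G x v v := by
    refine (isCompact_sphere _ _).eventually_forall_of_forall_eventually fun v hv ↦ ?_
    have hlt : a / 2 < G x₀ v v := (half_lt_self ha).trans_le (h v hv)
    filter_upwards [(cG v).eventually_const_lt hlt] with z hz using hz.le
  have hK : ∀ᶠ x in 𝓝 x₀, ∀ v ∈ Metric.closedBall (0 : E) (Real.sqrt (2 / a)),
      P x v = 0 → G x v v ≤ 1 → |Φ x v| < c := by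
    -- For each `v` of the ball one open condition persists: the strict bound if `v` is admissible
    -- at `x₀`, otherwise the failure of one of the two constraints.
    refine (isCompact_closedBall _ _).eventually_forall_of_forall_eventually fun v _ ↦ ?_
    have cP : ContinuousAt (fun z : M × E ↦ P z.1 z.2) (x₀, v) :=
      ContinuousAt.clm_apply (ContinuousAt.comp hP continuousAt_fst) continuousAt_snd
    have cΦ : ContinuousAt (fun z : M × E ↦ |Φ z.1 z.2|) (x₀, v) :=
      (ContinuousAt.clm_apply (ContinuousAt.comp hΦ continuousAt_fst) continuousAt_snd).abs
    by_cases p1 : P x₀ v = 0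
    · by_cases p2 : G x₀ v v ≤ 1
      · filter_upwards [cΦ.eventually_lt_const (hc v p1 p2)] with z hz _ _ using hz
      · filter_upwards [(cG v).eventually_const_lt (not_le.1 p2)] with z hz _ hz'
        exact absurd hz' (not_le.2 hz)
    · filter_upwards [cP.eventually_ne p1] with z hz hz'
      exact absurd hz' hz
  filter_upwards [h1, hK] with x hx hx' v hv hv'
  refine hx' v ?_ hv hv'
  rw [mem_closedBall_zero_iff]
  refine Real.le_sqrt_of_sq_le ?_
  have e := (mul_sq_norm_le_of_sphere (G x) hx v).trans hv'
  rw [le_div_iff₀ ha]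
  linarith

end Linear

/-! ### The dual norm of a metric and its semicontinuity -/

namespace TorusCollapse

variable {n : ℕ} {M : Type*} [TopologicalSpace M] [ChartedSpace (EuclideanSpace ℝ (Fin n)) M]
  [IsManifold 𝓘(ℝ, EuclideanSpace ℝ (Fin n)) ∞ M] {U : Set M}

namespace RiemMetricOn

variable (g : RiemMetricOn n M U) {x : M}
  {W : Set (TangentSpace 𝓘(ℝ, EuclideanSpace ℝ (Fin n)) x)}
  {β γ : TangentSpace 𝓘(ℝ, EuclideanSpace ℝ (Fin n)) x →L[ℝ] ℝ}

theorem le_dualNorm (hx : x ∈ U) {v : TangentSpace 𝓘(ℝ, EuclideanSpace ℝ (Fin n)) x} (hv : v ∈ W)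
    (hv1 : g.inner x v v ≤ 1) : |β v| ≤ g.dualNorm x W β :=
  le_csSup (bddAbove_abs_apply (E := EuclideanSpace ℝ (Fin n)) (g.inner x) (g.pos x hx) β W)
    ⟨v, hv, hv1, rfl⟩

theorem dualNorm_nonneg : 0 ≤ g.dualNorm x W β :=
  Real.sSup_nonneg (by rintro _ ⟨v, -, -, rfl⟩; exact abs_nonneg _)

theorem dualNorm_le {c : ℝ} (hc : 0 ≤ c) (h : ∀ v ∈ W, g.inner x v v ≤ 1 → |β v| ≤ c) :
    g.dualNorm x W β ≤ c :=
  Real.sSup_le (by rintro _ ⟨v, hv, hv1, rfl⟩; exact h v hv hv1) hc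

theorem dualNorm_le_add (hx : x ∈ U) :
    g.dualNorm x W β ≤ g.dualNorm x W γ + g.dualNorm x W (β - γ) := by
  refine g.dualNorm_le (add_nonneg g.dualNorm_nonneg g.dualNorm_nonneg) fun v hv hv1 ↦ ?_
  refine le_trans ?_ (add_le_add (g.le_dualNorm hx hv hv1) (g.le_dualNorm hx hv hv1))
  simpa using abs_add_le (γ v) ((β - γ) v)

theorem dualNorm_sub_comm : g.dualNorm x W (β - γ) = g.dualNorm x W (γ - β) := by
  simp only [dualNorm, _root_.sub_apply, abs_sub_comm]

theorem abs_dualNorm_sub_le (hx : x ∈ U) :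
    |g.dualNorm x W β - g.dualNorm x W γ| ≤ g.dualNorm x W (β - γ) := by
  have h1 := g.dualNorm_le_add (W := W) (β := β) (γ := γ) hx
  have h2 := g.dualNorm_le_add (W := W) (β := γ) (γ := β) hx
  rw [g.dualNorm_sub_comm] at h2
  rw [abs_le]
  constructor <;> linarith

/-- The length of the restriction of `dφ` to the kernel of `dp` is upper semicontinuous. -/
theorem eventually_dualNorm_ker_lt (hU : IsOpen U) (hx : x ∈ U) {m : ℕ} {N : Type*}
    [TopologicalSpace N] [ChartedSpace (EuclideanSpace ℝ (Fin m)) N]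
    [IsManifold 𝓘(ℝ, EuclideanSpace ℝ (Fin m)) ∞ N] {p : M → N} {φ : M → ℝ}
    (hp : ContMDiffAt 𝓘(ℝ, EuclideanSpace ℝ (Fin n)) 𝓘(ℝ, EuclideanSpace ℝ (Fin m)) ∞ p x)
    (hφ : ContMDiffAt 𝓘(ℝ, EuclideanSpace ℝ (Fin n)) 𝓘(ℝ, ℝ) ∞ φ x) {c : ℝ}
    (hc : g.dualNorm x {v | mfderiv 𝓘(ℝ, EuclideanSpace ℝ (Fin n))
      𝓘(ℝ, EuclideanSpace ℝ (Fin m)) p x v = 0} (differential φ x) < c) :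
    ∀ᶠ y in 𝓝 x, g.dualNorm y {v | mfderiv 𝓘(ℝ, EuclideanSpace ℝ (Fin n))
      𝓘(ℝ, EuclideanSpace ℝ (Fin m)) p y v = 0} (differential φ y) < c := by
  -- A supremum of values below `c'` is only known to be at most `c'`; the gap up to `c` restores
  -- strictness.
  obtain ⟨c', hc1, hc2⟩ := exists_between hc
  let E := EuclideanSpace ℝ (Fin n)
  let T : M → Type := fun y ↦ TangentSpace 𝓘(ℝ, EuclideanSpace ℝ (Fin n)) y
  have hsm := (g.smooth x hx).continuousWithinAt.continuousAt (hU.mem_nhds hx)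
  -- The metric, `dp` and `dφ` are read in the trivialisations at `x`, where they are continuous
  -- families of linear maps on fixed spaces.
  rw [continuousAt_hom_bundle] at hsm
  have hG := hsm.2
  have hP := (hp.mfderiv_const (m := 0) (by simp)).continuousAt
  have hΦ := (hφ.mfderiv_const (m := 0) (by simp)).continuousAt
  have hxb : x ∈ (trivializationAt E T x).baseSet := FiberBundle.mem_baseSet_trivializationAt' x
  have hb : (trivializationAt E T x).baseSet ∈ 𝓝 x :=
    (trivializationAt E T x).open_baseSet.mem_nhds hxb
  have hPe : ∀ y w, inTangentCoordinates 𝓘(ℝ, EuclideanSpace ℝ (Fin n))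
      𝓘(ℝ, EuclideanSpace ℝ (Fin m)) id p (mfderiv 𝓘(ℝ, EuclideanSpace ℝ (Fin n))
        𝓘(ℝ, EuclideanSpace ℝ (Fin m)) p) x y w =
      (trivializationAt (EuclideanSpace ℝ (Fin m)) (TangentSpace 𝓘(ℝ, EuclideanSpace ℝ (Fin m)))
        (p x)).continuousLinearMapAt ℝ (p y) (mfderiv 𝓘(ℝ, EuclideanSpace ℝ (Fin n))
          𝓘(ℝ, EuclideanSpace ℝ (Fin m)) p y ((trivializationAt E T x).symmL ℝ y w)) :=
    fun y w ↦ rfl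
  have hΦe : ∀ y w, inTangentCoordinates 𝓘(ℝ, EuclideanSpace ℝ (Fin n)) 𝓘(ℝ, ℝ) id φ
      (mfderiv 𝓘(ℝ, EuclideanSpace ℝ (Fin n)) 𝓘(ℝ, ℝ) φ) x y w =
      differential φ y ((trivializationAt E T x).symmL ℝ y w) := fun y w ↦ by
    change (trivializationAt ℝ (TangentSpace 𝓘(ℝ, ℝ)) (φ x)).continuousLinearMapAt ℝ (φ y)
      (differential φ y ((trivializationAt E T x).symmL ℝ y w)) = _
    rw [TangentBundle.continuousLinearMapAt_model_space]
    rfl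
  have hGe : ∀ y ∈ (trivializationAt E T x).baseSet, ∀ v w,
      ContinuousLinearMap.inCoordinates E T (E →L[ℝ] ℝ) (fun y ↦ T y →L[ℝ] ℝ) x y x y
        (g.inner y) v w = g.inner y ((trivializationAt E T x).symmL ℝ y v)
          ((trivializationAt E T x).symmL ℝ y w) := fun y hy v w ↦ by
    rw [inCoordinates_apply_eq₂ hy hy (mem_univ _), Bundle.Trivialization.symmL_apply _ hy,
      Bundle.Trivialization.symmL_apply _ hy]
    simp
  have key := eventually_forall_ker_abs_lt (c := c') hG hP hΦ ?_ ?_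
  · filter_upwards [key, hb] with y hy hyb
    refine lt_of_le_of_lt (g.dualNorm_le (g.dualNorm_nonneg.trans hc1.le) fun v hv hv1 ↦ ?_) hc2
    have hv' := (trivializationAt E T x).symmL_continuousLinearMapAt (R := ℝ) hyb v
    have h := hy ((trivializationAt E T x).continuousLinearMapAt ℝ y v)
    rw [hPe, hΦe, hGe y hyb, hv'] at h
    refine (h ?_ hv1).le
    rw [show mfderiv 𝓘(ℝ, EuclideanSpace ℝ (Fin n)) 𝓘(ℝ, EuclideanSpace ℝ (Fin m)) p y v = 0
      from hv, map_zero]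
  · intro v hv
    rw [hGe x hxb]
    refine g.pos x hx _ fun h0 ↦ hv ?_
    rw [← (trivializationAt E T x).continuousLinearMapAt_symmL (R := ℝ) hxb v, h0, map_zero]
  · intro v hv hv1
    rw [hΦe]
    rw [hGe x hxb] at hv1
    refine (g.le_dualNorm hx ?_ hv1).trans_lt hc1
    rw [hPe] at hv
    have h := congrArg ((trivializationAt (EuclideanSpace ℝ (Fin m))
      (TangentSpace 𝓘(ℝ, EuclideanSpace ℝ (Fin m))) (p x)).symmL ℝ (p x)) hv
    rwa [Bundle.Trivialization.symmL_continuousLinearMapAt _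
      (FiberBundle.mem_baseSet_trivializationAt' (p x)), map_zero] at h

end RiemMetricOn

end TorusCollapse

/-! ### Geometry of the fibres: vertical gradients and the first eigenvalue -/

namespace TorusCollapse.TorusFibration

variable {B : Type*} [TopologicalSpace B] [ChartedSpace (EuclideanSpace ℝ (Fin 2)) B]
  [IsManifold 𝓘(ℝ, EuclideanSpace ℝ (Fin 2)) ∞ B]
  {Breg B₀ : Set B} {gB : RiemMetricOn 2 B B₀}
  {X : Type*} [TopologicalSpace X] [ChartedSpace (EuclideanSpace ℝ (Fin 4)) X]
  [IsManifold 𝓘(ℝ, EuclideanSpace ℝ (Fin 4)) ∞ X]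
  (F : TorusFibration Breg B₀ gB X)

theorem isOpen_total (hB : IsOpen B₀) : IsOpen F.total :=
  hB.preimage F.proj_smooth.continuous

theorem proj_unif {b : B} (hb : b ∈ B₀) (y : EuclideanSpace ℝ (Fin 2)) :
    F.proj (F.unif b y) = b := by
  have : F.unif b y ∈ F.proj ⁻¹' {b} := F.unif_range b hb ▸ mem_range_self y
  exact this

theorem unif_mem_total {b : B} (hb : b ∈ B₀) (y : EuclideanSpace ℝ (Fin 2)) :
    F.unif b y ∈ F.total := by
  change F.proj (F.unif b y) ∈ B₀
  rwa [F.proj_unif hb]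

theorem vertNorm_nonneg {x : X} {β : TangentSpace 𝓘(ℝ, EuclideanSpace ℝ (Fin 4)) x →L[ℝ] ℝ} :
    0 ≤ F.vertNorm x β :=
  F.gRef.dualNorm_nonneg

theorem abs_vertNorm_sub_le {x : X} (hx : x ∈ F.total)
    {β γ : TangentSpace 𝓘(ℝ, EuclideanSpace ℝ (Fin 4)) x →L[ℝ] ℝ} :
    |F.vertNorm x β - F.vertNorm x γ| ≤ F.vertNorm x (β - γ) :=
  F.gRef.abs_dualNorm_sub_le hx

/-- A vector of `gRef`-length at most 1 has squared `g`-length at most `1 + δ`, so after rescaling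
it competes in the `g`-dual norm; restricting to vertical vectors only lowers the supremum. -/
theorem SemiFlat.vertNorm_le {F : TorusFibration Breg B₀ gB X} {δ : ℝ} (hF : F.SemiFlat δ)
    (hδ : 0 ≤ δ) {x : X} (hx : x ∈ F.total)
    (β : TangentSpace 𝓘(ℝ, EuclideanSpace ℝ (Fin 4)) x →L[ℝ] ℝ) :
    F.vertNorm x β ≤ Real.sqrt (1 + δ) * F.g.dualNorm x univ β := by
  have h0 : 0 < Real.sqrt (1 + δ) := Real.sqrt_pos.2 (by linarith)
  refine F.gRef.dualNorm_le (mul_nonneg h0.le F.g.dualNorm_nonneg) fun v _ hv ↦ ?_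
  have hnn : 0 ≤ F.gRef.inner x v v := by
    rcases eq_or_ne v 0 with rfl | h
    · simp
    · exact (F.gRef.pos x hx v h).le
  have h1 := (abs_le.1 (hF x hx v v)).2
  rw [Real.mul_self_sqrt hnn] at h1
  have h2 : F.g.inner x v v ≤ 1 + δ := by nlinarith
  have h3 := F.g.le_dualNorm (β := β) (mem_univ x)
    (mem_univ ((Real.sqrt (1 + δ))⁻¹ • v)) (by
      simp only [map_smul, _root_.smul_apply, smul_eq_mul]
      rw [← mul_assoc, ← mul_inv, Real.mul_self_sqrt (by linarith), inv_mul_le_iff₀ (by linarith)]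
      linarith)
  rw [map_smul, smul_eq_mul, abs_mul, abs_of_pos (inv_pos.2 h0), inv_mul_le_iff₀ h0] at h3
  exact h3

/-- Upper semicontinuity makes the strict sublevel sets open in `F.total`. The indicator is there
because neither `gRef` nor `φ` is controlled elsewhere. -/
theorem measurable_indicator_vertNorm [MeasurableSpace X] [BorelSpace X] (hB : IsOpen B₀)
    {φ : X → ℝ} (hφ : ContMDiffOn 𝓘(ℝ, EuclideanSpace ℝ (Fin 4)) 𝓘(ℝ, ℝ) ∞ φ F.total) :
    Measurable (F.total.indicator fun x ↦ F.vertNorm x (differential φ x)) := by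
  have ho := F.isOpen_total hB
  refine measurable_of_Iio fun c ↦ ?_
  by_cases hc : 0 < c
  · have e : (F.total.indicator fun x ↦ F.vertNorm x (differential φ x)) ⁻¹' Iio c
        = {x ∈ F.total | F.vertNorm x (differential φ x) < c} ∪ F.totalᶜ := by
      ext x
      by_cases hx : x ∈ F.total <;> simp [hx, hc]
    rw [e]
    refine (IsOpen.measurableSet ?_).union ho.measurableSet.compl
    rw [isOpen_iff_mem_nhds]
    rintro x ⟨hx, hxc⟩
    exact (ho.mem_nhds hx |> fun h ↦ Filter.inter_mem h
      (F.gRef.eventually_dualNorm_ker_lt ho hx F.proj_smooth.contMDiffAt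
        (hφ.contMDiffAt (ho.mem_nhds hx)) hxc))
  · convert! MeasurableSet.empty
    rw [eq_empty_iff_forall_notMem]
    intro x hx
    refine hc (lt_of_le_of_lt ?_ hx)
    exact indicator_nonneg (fun _ _ ↦ F.vertNorm_nonneg) x

theorem contDiff_comp_unif (hB : IsOpen B₀) {b : B} (hb : b ∈ B₀) {φ : X → ℝ}
    (hφ : ContMDiffOn 𝓘(ℝ, EuclideanSpace ℝ (Fin 4)) 𝓘(ℝ, ℝ) ∞ φ F.total) :
    ContDiff ℝ ∞ (fun y ↦ φ (F.unif b y)) := by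
  rw [← contMDiff_iff_contDiff]
  intro y
  exact (hφ.contMDiffAt ((F.isOpen_total hB).mem_nhds (F.unif_mem_total hb y))).comp y
    (F.unif_smooth b hb y)

/-- The gradient of `φ` along a fibre, read in the flat coordinates, is bounded by the vertical
gradient. -/
theorem sum_fderiv_sq_le (hB : IsOpen B₀) {b : B} (hb : b ∈ B₀) {φ : X → ℝ}
    (hφ : ContMDiffOn 𝓘(ℝ, EuclideanSpace ℝ (Fin 4)) 𝓘(ℝ, ℝ) ∞ φ F.total)
    (y : EuclideanSpace ℝ (Fin 2)) :
    ∑ j, fderiv ℝ (fun y ↦ φ (F.unif b y)) y (EuclideanSpace.basisFun (Fin 2) ℝ j) ^ 2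
      ≤ F.vertNorm (F.unif b y) (differential φ (F.unif b y)) ^ 2 := by
  set L := fderiv ℝ (fun y ↦ φ (F.unif b y)) y with hL
  have hx := F.unif_mem_total hb y
  have hu := (F.unif_smooth b hb y).mdifferentiableAt (by simp)
  have hLe : ∀ w, L w = differential φ (F.unif b y)
      (mfderiv 𝓘(ℝ, EuclideanSpace ℝ (Fin 2)) 𝓘(ℝ, EuclideanSpace ℝ (Fin 4)) (F.unif b) y w) := by
    intro w
    have h1 := (hφ.contMDiffAt ((F.isOpen_total hB).mem_nhds hx)).mdifferentiableAt (by simp)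
    have h2 := mfderiv_comp y h1 hu
    rw [hL, ← mfderiv_eq_fderiv]
    exact congrArg (fun T ↦ T w) h2
  have hvert : ∀ w, mfderiv 𝓘(ℝ, EuclideanSpace ℝ (Fin 4)) 𝓘(ℝ, EuclideanSpace ℝ (Fin 2)) F.proj
      (F.unif b y)
      (mfderiv 𝓘(ℝ, EuclideanSpace ℝ (Fin 2)) 𝓘(ℝ, EuclideanSpace ℝ (Fin 4)) (F.unif b) y w)
      = 0 := by
    intro w
    have h1 := (F.proj_smooth (F.unif b y)).mdifferentiableAt (by simp)
    have h2 := mfderiv_comp y h1 hu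
    have h3 : F.proj ∘ F.unif b = fun _ ↦ b := funext (F.proj_unif hb)
    rw [h3, mfderiv_const] at h2
    exact (congrArg (fun T ↦ T w) h2).symm
  -- The Riesz vector of the fibre derivative, normalised and pushed forward by the isometry `unif`,
  -- is a vertical unit vector on which `dφ` takes the value `‖w‖`.
  let w := (InnerProductSpace.toDual ℝ (EuclideanSpace ℝ (Fin 2))).symm L
  have hw : ∀ v, L v = inner ℝ w v := fun v ↦ by simp [w]
  have hs : ∑ j, L (EuclideanSpace.basisFun (Fin 2) ℝ j) ^ 2 = ‖w‖ ^ 2 := by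
    rw [← (EuclideanSpace.basisFun (Fin 2) ℝ).sum_sq_norm_inner_left w]
    simp only [hw, Real.norm_eq_abs, sq_abs]
  rw [hs]
  refine pow_le_pow_left₀ (norm_nonneg _) ?_ 2
  rcases eq_or_ne w 0 with h0 | h0
  · rw [h0, norm_zero]; exact F.vertNorm_nonneg
  have hn : ‖w‖ ≠ 0 := norm_ne_zero_iff.2 h0
  have h1 : L (‖w‖⁻¹ • w) = ‖w‖ := by
    rw [hw, inner_smul_right, real_inner_self_eq_norm_sq]; field_simp
  have hw1 : ‖‖w‖⁻¹ • w‖ = 1 := by rw [norm_smul, norm_inv, norm_norm, inv_mul_cancel₀ hn]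
  have h2 := F.gRef.le_dualNorm (β := differential φ (F.unif b y))
    (W := {v | mfderiv 𝓘(ℝ, EuclideanSpace ℝ (Fin 4)) 𝓘(ℝ, EuclideanSpace ℝ (Fin 2)) F.proj
      (F.unif b y) v = 0}) hx (hvert (‖w‖⁻¹ • w)) (by
    rw [F.unif_isometry b hb, real_inner_self_eq_norm_sq, hw1, one_pow])
  rw [← hLe, h1, abs_of_nonneg (norm_nonneg _)] at h2
  exact h2

/-- The first eigenvalue bounds the length of the nonzero vectors of the dual lattice. -/
theorem lambda1_le_freq {b : B} (hpos : 0 < F.lambda1 b) {n : Fin 2 → ℤ} (hn : n ≠ 0) :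
    F.lambda1 b ≤ 4 * Real.pi ^ 2 *
      ∑ j, ZSpan.freq (F.period b) n (EuclideanSpace.basisFun (Fin 2) ℝ j) ^ 2 := by
  -- `sInf` of a set not bounded below is 0, so positivity of `lambda1` already forces boundedness.
  have hbdd : BddBelow {l : ℝ | l ≠ 0 ∧ F.IsFiberEigenvalue b l} := by
    by_contra h
    rw [lambda1, Real.sInf_of_not_bddBelow h] at hpos
    exact lt_irrefl _ hpos
  refine csInf_le hbdd ⟨?_, ?_⟩
  · intro h0
    have h1 : ∑ j, ZSpan.freq (F.period b) n (EuclideanSpace.basisFun (Fin 2) ℝ j) ^ 2 = 0 := by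
      have : (4 * Real.pi ^ 2 : ℝ) ≠ 0 := by positivity
      simpa [this] using h0
    have h2 : ZSpan.freq (F.period b) n = 0 := by
      rw [Finset.sum_eq_zero_iff_of_nonneg fun _ _ ↦ sq_nonneg _] at h1
      refine ContinuousLinearMap.coe_injective
        ((EuclideanSpace.basisFun (Fin 2) ℝ).toBasis.ext fun j ↦ ?_)
      simpa using h1 j (Finset.mem_univ j)
    refine hn (funext fun i ↦ ?_)
    have := ZSpan.freq_basis (F.period b) n i
    rw [h2] at this
    change (0 : ℝ) = n i at this
    exact_mod_cast this.symm
  -- The eigenfunction is `cos (2π ⟨n, ·⟩)`: its frequency takes integer values on the lattice,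
  -- which gives periodicity.
  · let L : EuclideanSpace ℝ (Fin 2) →L[ℝ] ℝ := (2 * Real.pi) • ZSpan.freq (F.period b) n
    refine ⟨fun y ↦ Real.cos (L y), Real.contDiff_cos.comp L.contDiff, fun p hp y ↦ ?_,
      ⟨0, by simp⟩, fun y ↦ ?_⟩
    · obtain ⟨k, hk⟩ := ZSpan.exists_int_freq_eq (F.period b) n hp
      have : L (y + p) = L y + k * (2 * Real.pi) := by
        simp only [L, map_add, _root_.smul_apply, smul_eq_mul, hk]; ring
      simp only [this, Real.cos_add_int_mul_two_pi]
    · rw [ZSpan.laplacian_cos (EuclideanSpace.basisFun (Fin 2) ℝ) L y, neg_neg]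
      congr 1
      rw [Finset.mul_sum]
      refine Finset.sum_congr rfl fun j _ ↦ ?_
      simp only [L, _root_.smul_apply, smul_eq_mul]
      ring

end TorusCollapse.TorusFibration

/-! ### Poincaré on the fibres, from Haar measure to the weighted measure -/

namespace TorusCollapse.TorusFibration

variable {B : Type*} [TopologicalSpace B] [ChartedSpace (EuclideanSpace ℝ (Fin 2)) B]
  [IsManifold 𝓘(ℝ, EuclideanSpace ℝ (Fin 2)) ∞ B]
  {Breg B₀ : Set B} {gB : RiemMetricOn 2 B B₀}
  {X : Type*} [TopologicalSpace X] [ChartedSpace (EuclideanSpace ℝ (Fin 4)) X]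
  [IsManifold 𝓘(ℝ, EuclideanSpace ℝ (Fin 4)) ∞ X] [MeasurableSpace X] [BorelSpace X]
  (F : TorusFibration Breg B₀ gB X)

omit [BorelSpace X] in
theorem haar_eq (b : B) : F.haar b = (ZSpan.prob (F.period b)).map (F.unif b) := rfl

theorem measurable_unif {b : B} (hb : b ∈ B₀) : Measurable (F.unif b) :=
  (F.unif_smooth b hb).continuous.measurable

theorem ae_haar_proj [T2Space B] {b : B} (hb : b ∈ B₀) : ∀ᵐ x ∂F.haar b, F.proj x = b := by
  refine (ae_map_iff (F.measurable_unif hb).aemeasurable ?_).2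
    (ae_of_all _ fun y ↦ F.proj_unif hb y)
  exact ((isClosed_singleton (x := b)).preimage F.proj_smooth.continuous).measurableSet

theorem ae_haar_total [T2Space B] {b : B} (hb : b ∈ B₀) : ∀ᵐ x ∂F.haar b, x ∈ F.total := by
  filter_upwards [F.ae_haar_proj hb] with x hx
  change F.proj x ∈ B₀
  rwa [hx]

/-- The Poincaré inequality on a fibre. -/
theorem lintegral_haar_sub_sq_le [T2Space B] (hB : IsOpen B₀) {b : B} (hb : b ∈ B₀) {l : ℝ}
    (hl : 0 < l) (hl1 : l ≤ F.lambda1 b) {φ : X → ℝ}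
    (hφ : ContMDiffOn 𝓘(ℝ, EuclideanSpace ℝ (Fin 4)) 𝓘(ℝ, ℝ) ∞ φ F.total) :
    ∃ a : ℝ, ∫⁻ x, ‖φ x - a‖ₑ ^ 2 ∂F.haar b ≤ ENNReal.ofReal l⁻¹ *
      ∫⁻ x, ‖F.total.indicator (fun x ↦ F.vertNorm x (differential φ x)) x‖ₑ ^ 2 ∂F.haar b := by
  set f : EuclideanSpace ℝ (Fin 2) → ℝ := fun y ↦ φ (F.unif b y) with hf
  have hfs : ContDiff ℝ ∞ f := F.contDiff_comp_unif hB hb hφ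
  have hf1 : ContDiff ℝ 1 f := hfs.of_le (by simp)
  have hp : ∀ p ∈ Submodule.span ℤ (range (F.period b)), ∀ y, f (y + p) = f y := fun p hpm y ↦ by
    simp only [hf]
    rw [(F.unif_eq_iff b hb (y + p) y).2 (by simpa using hpm)]
  have key := ZSpan.poincare_of_freq_ge (F.period b) (EuclideanSpace.basisFun (Fin 2) ℝ)
    (fun n hn ↦ hl1.trans (F.lambda1_le_freq (hl.trans_le hl1) hn)) hf1 hp
  set m := ∫ z, f z ∂ZSpan.prob (F.period b)
  set D := fun y ↦ ∑ j, fderiv ℝ f y (EuclideanSpace.basisFun (Fin 2) ℝ j) ^ 2 with hD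
  have hbd : ∀ u : EuclideanSpace ℝ (Fin 2) → ℝ, Continuous u →
      Integrable u (ZSpan.prob (F.period b)) := fun u hu ↦ by
    have h1 : IntegrableOn u (ZSpan.fundamentalDomain (F.period b)) volume :=
      (hu.locallyIntegrable.integrableOn_isCompact
        (ZSpan.fundamentalDomain_isBounded (F.period b)).isCompact_closure).mono_set subset_closure
    exact Integrable.smul_measure h1
      (ENNReal.inv_ne_top.2 (ZSpan.measure_fundamentalDomain_ne_zero _))
  have hDc : Continuous D := continuous_finsetSum _ fun j _ ↦
    ((hf1.continuous_fderiv one_ne_zero).clm_apply continuous_const).pow 2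
  have hqc : Continuous fun y ↦ (f y - m) ^ 2 := (hf1.continuous.sub continuous_const).pow 2
  refine ⟨m, ?_⟩
  rw [haar_eq, lintegral_map ((F.measurable_indicator_vertNorm hB hφ).enorm.pow_const 2)
    (F.measurable_unif hb)]
  -- On this side `φ` may fail to be measurable off `F.total`; the inequality for push-forwards
  -- needs no measurability and points the right way.
  refine (lintegral_map_le _ _).trans ?_
  have e1 : ∫⁻ y, ‖φ (F.unif b y) - m‖ₑ ^ 2 ∂ZSpan.prob (F.period b)
      = ENNReal.ofReal (∫ y, (f y - m) ^ 2 ∂ZSpan.prob (F.period b)) := by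
    rw [ofReal_integral_eq_lintegral_ofReal (hbd _ hqc)
      (ae_of_all _ fun _ ↦ sq_nonneg _)]
    refine lintegral_congr fun x ↦ ?_
    rw [← sq_abs, ENNReal.ofReal_pow (abs_nonneg _), Real.enorm_eq_ofReal_abs]
  have e2 : ENNReal.ofReal (∫ y, D y ∂ZSpan.prob (F.period b)) ≤
      ∫⁻ y, ‖F.total.indicator (fun x ↦ F.vertNorm x (differential φ x)) (F.unif b y)‖ₑ ^ 2
        ∂ZSpan.prob (F.period b) := by
    rw [ofReal_integral_eq_lintegral_ofReal (hbd _ hDc)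
      (ae_of_all _ fun _ ↦ Finset.sum_nonneg fun _ _ ↦ sq_nonneg _)]
    refine lintegral_mono fun y ↦ ?_
    rw [indicator_of_mem (F.unif_mem_total hb y), Real.enorm_eq_ofReal F.vertNorm_nonneg,
      ← ENNReal.ofReal_pow F.vertNorm_nonneg]
    exact ENNReal.ofReal_le_ofReal (F.sum_fderiv_sq_le hB hb hφ y)
  rw [e1]
  refine le_trans ?_ (mul_le_mul_right e2 _)
  rw [← ENNReal.ofReal_mul (inv_nonneg.2 hl.le)]
  refine ENNReal.ofReal_le_ofReal ?_
  rw [le_inv_mul_iff₀ hl]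
  exact key

/-- The fibre measure `ρ ϑ_b`. -/
noncomputable def fiberMeasure (ρ : X → ℝ) (b : B) : Measure X :=
  (F.haar b).withDensity fun x ↦ ENNReal.ofReal (ρ x)

/-- The base measure `A μ_B` on `B₀`. -/
noncomputable def baseMeasure [MeasurableSpace B] (_ : TorusFibration Breg B₀ gB X)
    (A : B → ℝ) : Measure B :=
  (gB.measure.restrict B₀).withDensity fun b ↦ ENNReal.ofReal (A b)

omit [MeasurableSpace X] [BorelSpace X] in
theorem ae_baseMeasure [MeasurableSpace B] [BorelSpace B] (hB : IsOpen B₀) (A : B → ℝ)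
    {P : B → Prop} (h : ∀ b ∈ B₀, P b) : ∀ᵐ b ∂F.baseMeasure A, P b := by
  refine (withDensity_absolutelyContinuous _ _).ae_le ?_
  filter_upwards [ae_restrict_mem hB.measurableSet] with b hb using h b hb

namespace IsDisintegration

variable {F} [MeasurableSpace B] [BorelSpace B] [T2Space B] {A : B → ℝ} {ρ : X → ℝ}
  (h : F.IsDisintegration A ρ)
include h

omit [BorelSpace X] [BorelSpace B] [T2Space B] in
theorem lintegral_fiberMeasure {f : X → ℝ≥0∞} (hf : Measurable f) (b : B) :
    ∫⁻ x, f x ∂F.fiberMeasure ρ b = ∫⁻ x, f x * ENNReal.ofReal (ρ x) ∂F.haar b := by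
  rw [fiberMeasure, lintegral_withDensity_eq_lintegral_mul _ h.measurable_ρ.ennreal_ofReal hf]
  simp only [Pi.mul_apply, mul_comm]

omit [BorelSpace B] in
theorem ae_haar_pos {b : B} (hb : b ∈ B₀) : ∀ᵐ x ∂F.haar b, 0 < ρ x := by
  filter_upwards [F.ae_haar_total hb] with x hx using h.ρ_pos x hx

omit [BorelSpace B] in
theorem isProbabilityMeasure_fiberMeasure {b : B} (hb : b ∈ B₀) :
    IsProbabilityMeasure (F.fiberMeasure ρ b) := by
  refine ⟨?_⟩
  rw [fiberMeasure, withDensity_apply _ MeasurableSet.univ, Measure.restrict_univ]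
  have hi : Integrable ρ (F.haar b) := by
    -- The integral of a nonintegrable function is 0 by convention, contradicting the normalisation
    -- to 1.
    by_contra hn
    simpa [integral_undef hn] using h.normalized b hb
  rw [← ofReal_integral_eq_lintegral_ofReal hi ((h.ae_haar_pos hb).mono fun _ hx ↦ hx.le),
    h.normalized b hb, ENNReal.ofReal_one]

omit [BorelSpace B] in
theorem integral_fiberMeasure {b : B} (hb : b ∈ B₀) (u : X → ℝ) :
    ∫ x, u x ∂F.fiberMeasure ρ b = ∫ x, u x * ρ x ∂F.haar b := by
  rw [fiberMeasure, integral_withDensity_eq_integral_toReal_smul h.measurable_ρ.ennreal_ofReal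
    (ae_of_all _ fun _ ↦ ENNReal.ofReal_lt_top)]
  refine integral_congr_ae ?_
  filter_upwards [h.ae_haar_pos hb] with x hx
  rw [ENNReal.toReal_ofReal hx.le, smul_eq_mul, mul_comm]

theorem fiberDisintegration (hB : IsOpen B₀) :
    FiberDisintegration F.proj F.mu (F.baseMeasure A) (F.fiberMeasure ρ) where
  measurable_proj := F.proj_smooth.continuous.measurable
  prob := F.ae_baseMeasure hB A fun _ hb ↦ h.isProbabilityMeasure_fiberMeasure hb
  fiber := F.ae_baseMeasure hB A fun _ hb ↦
    (withDensity_absolutelyContinuous _ _).ae_le (F.ae_haar_proj hb)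
  aemeasurable f hf := by
    simp only [h.lintegral_fiberMeasure hf]
    exact (h.aemeasurable f hf).mono_ac (withDensity_absolutelyContinuous _ _)
  lintegral_eq f hf := by
    simp only [h.lintegral_fiberMeasure hf]
    rw [h.lintegral_eq f hf, baseMeasure, lintegral_withDensity_eq_lintegral_mul₀
      h.measurable_A.ennreal_ofReal.aemeasurable (h.aemeasurable f hf)]
    rfl

omit [BorelSpace B] in
theorem osc_eq {u : X → ℝ} {x : X} (hx : x ∈ F.total) :
    F.osc A ρ u x = u x - ∫ y, u y ∂F.fiberMeasure ρ (F.proj x) := by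
  have hA := h.A_pos (F.proj x) hx
  rw [osc, lift, avg, h.integral_fiberMeasure hx, ← mul_assoc, ← Real.rpow_add hA]
  norm_num

theorem osc_ae_eq (hB : IsOpen B₀) (u : X → ℝ) :
    F.osc A ρ u =ᵐ[F.mu] fun x ↦ u x - ∫ y, u y ∂F.fiberMeasure ρ (F.proj x) := by
  filter_upwards [ae_restrict_mem (F.isOpen_total hB).measurableSet] with x hx using h.osc_eq hx

/-- The weighted Poincaré inequality on almost every fibre. -/
theorem ae_lintegral_fiberMeasure_le (hB : IsOpen B₀) {l : ℝ} (hl : 0 < l)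
    (hl1 : ∀ b ∈ B₀, l ≤ F.lambda1 b) (hρ : ∀ᵐ x ∂F.mu, |ρ x - 1| ≤ 1 / 2) {φ : X → ℝ}
    (hφ : ContMDiffOn 𝓘(ℝ, EuclideanSpace ℝ (Fin 4)) 𝓘(ℝ, ℝ) ∞ φ F.total)
    (hφ2 : MemLp φ 2 F.mu) :
    ∀ᵐ b ∂F.baseMeasure A,
      ∫⁻ x, ‖φ x - ∫ y, φ y ∂F.fiberMeasure ρ b‖ₑ ^ 2 ∂F.fiberMeasure ρ b ≤
        ENNReal.ofReal (Real.sqrt (3 * l⁻¹)) ^ 2 *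
          ∫⁻ x, ‖F.total.indicator (fun x ↦ F.vertNorm x (differential φ x)) x‖ₑ ^ 2
            ∂F.fiberMeasure ρ b := by
  have hd := h.fiberDisintegration hB
  filter_upwards [hd.ae_ae hρ, hd.ae_memLp_two hφ2,
    F.ae_baseMeasure hB A (P := fun b ↦ b ∈ B₀) fun _ hb ↦ hb] with b hb1 hb2 hb
  have := h.isProbabilityMeasure_fiberMeasure hb
  -- Since `ρ > 0` almost everywhere on the fibre, null sets of `ρ ϑ_b` are null for `ϑ_b`.
  have hb1' : ∀ᵐ x ∂F.haar b, |ρ x - 1| ≤ 1 / 2 := by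
    rw [fiberMeasure, ae_withDensity_iff h.measurable_ρ.ennreal_ofReal] at hb1
    filter_upwards [hb1, h.ae_haar_pos hb] with x hx hx'
    exact hx (by simpa using hx')
  obtain ⟨a, ha⟩ := F.lintegral_haar_sub_sq_le hB hb hl (hl1 b hb) hφ
  have hV := (F.measurable_indicator_vertNorm hB hφ).enorm.pow_const 2
  have hφm : AEMeasurable φ (F.haar b) := by
    rw [← Measure.restrict_eq_self_of_ae_mem (F.ae_haar_total hb)]
    exact hφ.continuousOn.aemeasurable (F.isOpen_total hB).measurableSet
  have up : ∫⁻ x, ‖φ x - a‖ₑ ^ 2 ∂F.fiberMeasure ρ b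
      ≤ ENNReal.ofReal (3 / 2) * ∫⁻ x, ‖φ x - a‖ₑ ^ 2 ∂F.haar b := by
    rw [fiberMeasure, lintegral_withDensity_eq_lintegral_mul₀
      h.measurable_ρ.ennreal_ofReal.aemeasurable ((hφm.sub_const a).enorm.pow_const 2),
      ← lintegral_const_mul'' _ ((hφm.sub_const a).enorm.pow_const 2)]
    refine lintegral_mono_ae ?_
    filter_upwards [hb1'] with x hx
    refine mul_le_mul_left (ENNReal.ofReal_le_ofReal ?_) _
    linarith [(abs_le.1 hx).2]
  have dn : ENNReal.ofReal (1 / 2) *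
      ∫⁻ x, ‖F.total.indicator (fun x ↦ F.vertNorm x (differential φ x)) x‖ₑ ^ 2 ∂F.haar b ≤
      ∫⁻ x, ‖F.total.indicator (fun x ↦ F.vertNorm x (differential φ x)) x‖ₑ ^ 2
        ∂F.fiberMeasure ρ b := by
    rw [fiberMeasure, lintegral_withDensity_eq_lintegral_mul _ h.measurable_ρ.ennreal_ofReal hV,
      ← lintegral_const_mul _ hV]
    refine lintegral_mono_ae ?_
    filter_upwards [hb1'] with x hx
    refine mul_le_mul_left (ENNReal.ofReal_le_ofReal ?_) _
    linarith [(abs_le.1 hx).1]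
  -- Weighted mean to Haar mean, then `ρ ≤ 3/2`, the Haar inequality, and `ρ ≥ 1/2`: the constant is
  -- `3 l⁻¹ · (1/2) = (3/2) l⁻¹`.
  refine (FiberDisintegration.lintegral_sub_integral_sq_le hb2 a).trans (up.trans ?_)
  refine (mul_le_mul_right ha _).trans ?_
  refine le_trans (le_of_eq ?_) (mul_le_mul_right dn _)
  rw [← ENNReal.ofReal_pow (Real.sqrt_nonneg _), Real.sq_sqrt (by positivity), ← mul_assoc,
    ← mul_assoc, ← ENNReal.ofReal_mul (by norm_num), ← ENNReal.ofReal_mul (by positivity)]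
  congr 2
  ring

theorem eLpNorm_osc_le_of_contMDiffOn (hB : IsOpen B₀) {l : ℝ} (hl : 0 < l)
    (hl1 : ∀ b ∈ B₀, l ≤ F.lambda1 b) (hρ : ∀ᵐ x ∂F.mu, |ρ x - 1| ≤ 1 / 2) {φ : X → ℝ}
    (hφ : ContMDiffOn 𝓘(ℝ, EuclideanSpace ℝ (Fin 4)) 𝓘(ℝ, ℝ) ∞ φ F.total)
    (hφ2 : MemLp φ 2 F.mu) :
    eLpNorm (F.osc A ρ φ) 2 F.mu ≤ ENNReal.ofReal (Real.sqrt (3 * l⁻¹)) *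
      eLpNorm (fun x ↦ F.vertNorm x (differential φ x)) 2 F.mu := by
  rw [eLpNorm_congr_ae (h.osc_ae_eq hB φ)]
  refine ((h.fiberDisintegration hB).eLpNorm_sub_integral_le hφ2
    (F.measurable_indicator_vertNorm hB hφ).aemeasurable
    (h.ae_lintegral_fiberMeasure_le hB hl hl1 hρ hφ hφ2)).trans_eq ?_
  congr 1
  exact eLpNorm_congr_ae (indicator_ae_eq_restrict (F.isOpen_total hB).measurableSet)

theorem memLp_osc (hB : IsOpen B₀) {u : X → ℝ} (hu : MemLp u 2 F.mu) :
    MemLp (F.osc A ρ u) 2 F.mu := by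
  have hd := h.fiberDisintegration hB
  exact MemLp.ae_eq (h.osc_ae_eq hB u).symm ⟨hd.aestronglyMeasurable_sub_integral hu,
    (hd.eLpNorm_sub_integral_le_self hu).trans_lt hu.eLpNorm_lt_top⟩

theorem eLpNorm_osc_le (hB : IsOpen B₀) {u : X → ℝ} (hu : MemLp u 2 F.mu) :
    eLpNorm (F.osc A ρ u) 2 F.mu ≤ eLpNorm u 2 F.mu := by
  rw [eLpNorm_congr_ae (h.osc_ae_eq hB u)]
  exact (h.fiberDisintegration hB).eLpNorm_sub_integral_le_self hu

/-- Additivity of fibre means needs integrability on the fibre, which an `L²` function has only on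
almost every one. -/
theorem osc_sub_ae_eq (hB : IsOpen B₀) {u v : X → ℝ} (hu : MemLp u 2 F.mu)
    (hv : MemLp v 2 F.mu) :
    F.osc A ρ (fun x ↦ u x - v x) =ᵐ[F.mu] fun x ↦ F.osc A ρ u x - F.osc A ρ v x := by
  have hd := h.fiberDisintegration hB
  have h1 := hd.quasiMeasurePreserving.ae (hd.ae_memLp_two hu)
  have h2 := hd.quasiMeasurePreserving.ae (hd.ae_memLp_two hv)
  have h3 := hd.quasiMeasurePreserving.ae hd.prob
  filter_upwards [h1, h2, h3, h.osc_ae_eq hB u, h.osc_ae_eq hB v,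
    h.osc_ae_eq hB (fun x ↦ u x - v x)] with x x1 x2 x3 x4 x5 x6
  rw [x4, x5, x6, integral_sub (x1.integrable one_le_two) (x2.integrable one_le_two)]
  ring

end IsDisintegration

end TorusCollapse.TorusFibration

/-! ### Passage from smooth functions to `H¹` -/

namespace TorusCollapse.TorusFibration

theorem integral_sq_eq_toReal_eLpNorm {α : Type*} [MeasurableSpace α] {μ : Measure α} {f : α → ℝ}
    (hf : MemLp f 2 μ) : ∫ x, f x ^ 2 ∂μ = (eLpNorm f 2 μ).toReal ^ 2 := by
  have h := hf.eLpNorm_eq_integral_rpow_norm two_ne_zero ENNReal.ofNat_ne_top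
  have h0 : 0 ≤ ∫ x, f x ^ 2 ∂μ := integral_nonneg fun _ ↦ sq_nonneg _
  simp only [ENNReal.toReal_ofNat, Real.rpow_ofNat, Real.norm_eq_abs, sq_abs] at h
  rw [h, ENNReal.toReal_ofReal (Real.rpow_nonneg h0 _), ← Real.rpow_natCast, ← Real.rpow_mul h0]
  norm_num

variable {B : Type*} [TopologicalSpace B] [ChartedSpace (EuclideanSpace ℝ (Fin 2)) B]
  [IsManifold 𝓘(ℝ, EuclideanSpace ℝ (Fin 2)) ∞ B]
  {Breg B₀ : Set B} {gB : RiemMetricOn 2 B B₀}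
  {X : Type*} [TopologicalSpace X] [ChartedSpace (EuclideanSpace ℝ (Fin 4)) X]
  [IsManifold 𝓘(ℝ, EuclideanSpace ℝ (Fin 4)) ∞ X] [MeasurableSpace X] [BorelSpace X]
  {F : TorusFibration Breg B₀ gB X}

/-- Convergence of the vertical gradients along an `H¹`-approximation. -/
theorem SemiFlat.eLpNorm_vertNorm_sub_le (hB : IsOpen B₀) {δ : ℝ} (hF : F.SemiFlat δ) (hδ : 0 ≤ δ)
    (α β : ∀ x : X, TangentSpace 𝓘(ℝ, EuclideanSpace ℝ (Fin 4)) x →L[ℝ] ℝ) :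
    eLpNorm (fun x ↦ F.vertNorm x (α x) - F.vertNorm x (β x)) 2 F.mu ≤
      ENNReal.ofReal (Real.sqrt (1 + δ)) *
        eLpNorm (fun x ↦ F.g.dualNorm x univ (α x - β x)) 2 F.mu := by
  refine eLpNorm_le_mul_eLpNorm_of_ae_le_mul ?_ 2
  filter_upwards [ae_restrict_mem (F.isOpen_total hB).measurableSet] with x hx
  rw [Real.norm_eq_abs, Real.norm_eq_abs, abs_of_nonneg F.g.dualNorm_nonneg]
  exact (F.abs_vertNorm_sub_le hx).trans (hF.vertNorm_le hδ hx _)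

theorem memLp_vertNorm (hB : IsOpen B₀) {δ : ℝ} (hF : F.SemiFlat δ) (hδ : 0 ≤ δ) {u : X → ℝ}
    {α : ∀ x : X, TangentSpace 𝓘(ℝ, EuclideanSpace ℝ (Fin 4)) x →L[ℝ] ℝ}
    (h : F.g.IsH1 F.total u α) : MemLp (fun x ↦ F.vertNorm x (α x)) 2 F.mu := by
  obtain ⟨φ, hφ, -, h2, -, h4⟩ := h.approx
  have ho := (F.isOpen_total hB).measurableSet
  refine MemLp.of_le_mul (c := Real.sqrt (1 + δ)) h.memLp_differential ?_ ?_
  -- The field `α` carries no measurability of its own. Along a subsequence `dφ_k → α` in dual norm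
  -- almost everywhere, so the vertical norm is an almost everywhere limit of measurable functions.
  · obtain ⟨ns, -, hns⟩ := (tendstoInMeasure_of_tendsto_eLpNorm two_ne_zero
      (fun k ↦ (h2 k).1) (aestronglyMeasurable_const (b := (0 : ℝ)))
      (h4.congr fun k ↦ congrArg (eLpNorm · 2 F.mu) (by ext x; simp))).exists_seq_tendsto_ae
    refine aestronglyMeasurable_of_tendsto_ae atTop
      (f := fun k x ↦ F.vertNorm x (differential (φ (ns k)) x)) (fun k ↦ ?_) ?_
    · exact ((F.measurable_indicator_vertNorm hB (hφ (ns k))).aemeasurable.congr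
        (indicator_ae_eq_restrict ho)).aestronglyMeasurable
    · filter_upwards [hns, ae_restrict_mem ho] with x hx hxt
      rw [tendsto_iff_norm_sub_tendsto_zero]
      have hx' := hx.const_mul (Real.sqrt (1 + δ))
      rw [mul_zero] at hx'
      refine squeeze_zero (fun _ ↦ norm_nonneg _) (fun k ↦ ?_) hx'
      exact (F.abs_vertNorm_sub_le hxt).trans (hF.vertNorm_le hδ hxt _)
  · filter_upwards [ae_restrict_mem ho] with x hx
    rw [Real.norm_eq_abs, Real.norm_eq_abs, abs_of_nonneg F.g.dualNorm_nonneg,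
      abs_of_nonneg F.vertNorm_nonneg]
    exact hF.vertNorm_le hδ hx _

variable [MeasurableSpace B] [BorelSpace B] [T2Space B] {A : B → ℝ} {ρ : X → ℝ}

/-- The global vertical Poincaré inequality at a fixed parameter. -/
theorem IsDisintegration.eLpNorm_osc_le_of_isH1 (h : F.IsDisintegration A ρ) (hB : IsOpen B₀)
    {δ : ℝ} (hF : F.SemiFlat δ) (hδ : 0 ≤ δ) {l : ℝ} (hl : 0 < l)
    (hl1 : ∀ b ∈ B₀, l ≤ F.lambda1 b) (hρ : ∀ᵐ x ∂F.mu, |ρ x - 1| ≤ 1 / 2) {u : X → ℝ}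
    {α : ∀ x : X, TangentSpace 𝓘(ℝ, EuclideanSpace ℝ (Fin 4)) x →L[ℝ] ℝ}
    (hu : F.g.IsH1 F.total u α) :
    eLpNorm (F.osc A ρ u) 2 F.mu ≤ ENNReal.ofReal (Real.sqrt (3 * l⁻¹)) *
      eLpNorm (fun x ↦ F.vertNorm x (α x)) 2 F.mu := by
  obtain ⟨φ, hφ, h1, h2, h3, h4⟩ := hu.approx
  set K := ENNReal.ofReal (Real.sqrt (3 * l⁻¹))
  set S := ENNReal.ofReal (Real.sqrt (1 + δ))
  have hV := memLp_vertNorm hB hF hδ hu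
  have hφ2 : ∀ k, MemLp (φ k) 2 F.mu := fun k ↦ by
    have h := (h1 k).add hu.memLp
    rwa [show (fun x ↦ φ k x - u x) + u = φ k by ext x; simp] at h
  -- Write `u = φ k - (φ k - u)`: the smooth estimate handles the first term, the contraction
  -- property of `osc` the second. Both error terms tend to 0 with `k`.
  have hbound : ∀ k, eLpNorm (F.osc A ρ u) 2 F.mu ≤
      K * (S * eLpNorm (fun x ↦ F.g.dualNorm x univ (differential (φ k) x - α x)) 2 F.mu +
        eLpNorm (fun x ↦ F.vertNorm x (α x)) 2 F.mu) +
      eLpNorm (fun x ↦ φ k x - u x) 2 F.mu := by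
    intro k
    have hVk : AEStronglyMeasurable (fun x ↦ F.vertNorm x (differential (φ k) x)) F.mu :=
      ((F.measurable_indicator_vertNorm hB (hφ k)).aemeasurable.congr
        (indicator_ae_eq_restrict (F.isOpen_total hB).measurableSet)).aestronglyMeasurable
    have e1 : eLpNorm (F.osc A ρ u) 2 F.mu ≤ eLpNorm (F.osc A ρ (φ k)) 2 F.mu +
        eLpNorm (F.osc A ρ fun x ↦ φ k x - u x) 2 F.mu := by
      refine le_trans (le_of_eq (eLpNorm_congr_ae ?_)) (eLpNorm_sub_le
        (h.memLp_osc hB (hφ2 k)).1 (h.memLp_osc hB (h1 k)).1 one_le_two)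
      filter_upwards [h.osc_sub_ae_eq hB (hφ2 k) hu.memLp] with x hx
      simp [hx]
    have e2 : eLpNorm (fun x ↦ F.vertNorm x (differential (φ k) x)) 2 F.mu ≤
        eLpNorm (fun x ↦ F.vertNorm x (differential (φ k) x) - F.vertNorm x (α x)) 2 F.mu +
          eLpNorm (fun x ↦ F.vertNorm x (α x)) 2 F.mu := by
      refine le_trans (le_of_eq ?_) (eLpNorm_add_le (hVk.sub hV.1) hV.1 one_le_two)
      congr 1
      ext x
      simp
    refine e1.trans (add_le_add ((h.eLpNorm_osc_le_of_contMDiffOn hB hl hl1 hρ (hφ k)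
      (hφ2 k)).trans ?_) (h.eLpNorm_osc_le hB (h1 k)))
    exact mul_le_mul_right (e2.trans (add_le_add_left
      (hF.eLpNorm_vertNorm_sub_le hB hδ _ _) _)) _
  have hlim : Tendsto (fun k ↦
      K * (S * eLpNorm (fun x ↦ F.g.dualNorm x univ (differential (φ k) x - α x)) 2 F.mu +
        eLpNorm (fun x ↦ F.vertNorm x (α x)) 2 F.mu) +
      eLpNorm (fun x ↦ φ k x - u x) 2 F.mu) atTop
      (𝓝 (K * (S * 0 + eLpNorm (fun x ↦ F.vertNorm x (α x)) 2 F.mu) + 0)) := by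
    refine Tendsto.add (ENNReal.Tendsto.const_mul (Tendsto.add
      (ENNReal.Tendsto.const_mul h4 (Or.inr ENNReal.ofReal_ne_top)) tendsto_const_nhds)
      (Or.inr ENNReal.ofReal_ne_top)) h3
  rw [mul_zero, zero_add, add_zero] at hlim
  exact ge_of_tendsto' hlim hbound

theorem IsDisintegration.integral_osc_sq_le (h : F.IsDisintegration A ρ) (hB : IsOpen B₀)
    {δ : ℝ} (hF : F.SemiFlat δ) (hδ : 0 ≤ δ) {l : ℝ} (hl : 0 < l)
    (hl1 : ∀ b ∈ B₀, l ≤ F.lambda1 b) (hρ : ∀ᵐ x ∂F.mu, |ρ x - 1| ≤ 1 / 2) {u : X → ℝ}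
    {α : ∀ x : X, TangentSpace 𝓘(ℝ, EuclideanSpace ℝ (Fin 4)) x →L[ℝ] ℝ}
    (hu : F.g.IsH1 F.total u α) :
    ∫ x, F.osc A ρ u x ^ 2 ∂F.mu ≤ 3 * l⁻¹ * ∫ x, F.vertNorm x (α x) ^ 2 ∂F.mu := by
  have hV := memLp_vertNorm hB hF hδ hu
  rw [integral_sq_eq_toReal_eLpNorm (h.memLp_osc hB hu.memLp), integral_sq_eq_toReal_eLpNorm hV]
  have h1 := ENNReal.toReal_mono (ENNReal.mul_ne_top ENNReal.ofReal_ne_top hV.eLpNorm_ne_top)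
    (h.eLpNorm_osc_le_of_isH1 hB hF hδ hl hl1 hρ hu)
  rw [ENNReal.toReal_mul, ENNReal.toReal_ofReal (Real.sqrt_nonneg _)] at h1
  refine (pow_le_pow_left₀ ENNReal.toReal_nonneg h1 2).trans_eq ?_
  rw [mul_pow, Real.sq_sqrt (by positivity)]

end TorusCollapse.TorusFibration

/-! ### Choice of `t₁` and uniformity in `t` -/

theorem exists_forall_le_half {t₀ : ℝ} (ht₀ : 0 < t₀) {f : ℝ → ℝ} (hf : Tendsto f (𝓝[>] 0) (𝓝 0)) :
    ∃ t₁ ∈ Set.Ioc (0 : ℝ) t₀, ((∀ t ∈ Set.Ioc (0 : ℝ) t₀, f t ≤ 1 / 2) → t₁ = t₀) ∧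
      ∀ t ∈ Set.Ioc (0 : ℝ) t₀, t ≤ t₁ → f t ≤ 1 / 2 := by
  by_cases h : ∀ t ∈ Set.Ioc (0 : ℝ) t₀, f t ≤ 1 / 2
  · exact ⟨t₀, ⟨ht₀, le_rfl⟩, fun _ ↦ rfl, fun t ht _ ↦ h t ht⟩
  · have h1 := hf.eventually_le_const (show (0 : ℝ) < 1 / 2 by norm_num)
    obtain ⟨r, hr, hr'⟩ := mem_nhdsGT_iff_exists_Ioc_subset.1 h1
    exact ⟨min r t₀, ⟨lt_min hr ht₀, min_le_right _ _⟩, fun h' ↦ absurd h' h,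
      fun t ht htr ↦ hr' ⟨ht.1, htr.trans (min_le_left _ _)⟩⟩

theorem mainTheorem8
    {B : Type*} [TopologicalSpace B] [T2Space B] [SecondCountableTopology B]
    [ChartedSpace (EuclideanSpace ℝ (Fin 2)) B]
    [IsManifold 𝓘(ℝ, EuclideanSpace ℝ (Fin 2)) ∞ B]
    [MeasurableSpace B] [BorelSpace B]
    (D : Finset B) (B₀ : Set B) (hB₀_open : IsOpen B₀)
    (hB₀_compact : IsCompact (closure B₀)) (hB₀_reg : closure B₀ ⊆ (↑D : Set B)ᶜ)
    (gB : TorusCollapse.RiemMetricOn 2 B B₀)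
    (t₀ : ℝ) (ht₀ : 0 < t₀)
    (X : Set.Ioc (0 : ℝ) t₀ → Type*) [∀ t, TopologicalSpace (X t)] [∀ t, T2Space (X t)]
    [∀ t, SecondCountableTopology (X t)]
    [∀ t, ChartedSpace (EuclideanSpace ℝ (Fin 4)) (X t)]
    [∀ t, IsManifold 𝓘(ℝ, EuclideanSpace ℝ (Fin 4)) ∞ (X t)]
    [∀ t, MeasurableSpace (X t)] [∀ t, BorelSpace (X t)]
    (F : ∀ t, TorusCollapse.TorusFibration (↑D : Set B)ᶜ B₀ gB (X t))
    (s ε : ℝ → ℝ) (hs_pos : ∀ t ∈ Set.Ioc (0 : ℝ) t₀, 0 < s t)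
    (hs_lim : Tendsto s (𝓝[>] 0) (𝓝 0))
    (hε_nonneg : ∀ t ∈ Set.Ioc (0 : ℝ) t₀, 0 ≤ ε t)
    (hε_lim : Tendsto ε (𝓝[>] 0) (𝓝 0))
    (hsf : ∀ t : Set.Ioc (0 : ℝ) t₀, (F t).SemiFlat (ε t))
    (c_gap : ℝ) (hc_gap : 0 < c_gap)
    (hgap : ∀ t : Set.Ioc (0 : ℝ) t₀, ∀ b ∈ B₀, c_gap * (s t ^ 2)⁻¹ ≤ (F t).lambda1 b)
    (A : Set.Ioc (0 : ℝ) t₀ → B → ℝ) (ρ : ∀ t, X t → ℝ)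
    (hdis : ∀ t, (F t).IsDisintegration (A t) (ρ t))
    (C₁ : ℝ) (hρ : ∀ t, ∀ᵐ x ∂(F t).mu, |ρ t x - 1| ≤ C₁ * ε t) :
    ∃ C > 0, ∃ c > 0, ∃ t₁ ∈ Set.Ioc (0 : ℝ) t₀,
      ((∀ t ∈ Set.Ioc (0 : ℝ) t₀, C₁ * ε t ≤ 1 / 2) → t₁ = t₀) ∧
      ∀ t : Set.Ioc (0 : ℝ) t₀, (t : ℝ) ≤ t₁ →
        ∀ (u : X t → ℝ)
          (du : ∀ x : X t, TangentSpace 𝓘(ℝ, EuclideanSpace ℝ (Fin 4)) x →L[ℝ] ℝ),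
          (F t).g.IsH1 (F t).total u du →
          MemLp ((F t).osc (A t) (ρ t) u) 2 (F t).mu ∧
          MemLp (fun x ↦ (F t).vertNorm x (du x)) 2 (F t).mu ∧
          ∫ x, (F t).osc (A t) (ρ t) u x ^ 2 ∂(F t).mu ≤
            C * s t ^ 2 * ∫ x, (F t).vertNorm x (du x) ^ 2 ∂(F t).mu ∧
          c * (s t ^ 2)⁻¹ * ∫ x, (F t).osc (A t) (ρ t) u x ^ 2 ∂(F t).mu ≤
            ∫ x, (F t).vertNorm x (du x) ^ 2 ∂(F t).mu := by
  obtain ⟨t₁, ht₁, h1, h2⟩ := exists_forall_le_half ht₀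
    (f := fun t ↦ C₁ * ε t) (by simpa using hε_lim.const_mul C₁)
  -- With `l = c_gap / s²` the factor `3 l⁻¹` is `3 s² / c_gap`; the second constant is the
  -- reciprocal of the first.
  refine ⟨3 * c_gap⁻¹, by positivity, c_gap / 3, by positivity, t₁, ht₁, h1, ?_⟩
  intro t htt u du hu
  have hst := hs_pos t t.2
  have hρt : ∀ᵐ x ∂(F t).mu, |ρ t x - 1| ≤ 1 / 2 := by
    filter_upwards [hρ t] with x hx using hx.trans (h2 t t.2 htt)
  have key := (hdis t).integral_osc_sq_le hB₀_open (hsf t) (hε_nonneg t t.2)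
    (show 0 < c_gap * (s t ^ 2)⁻¹ by positivity) (hgap t) hρt hu
  have key' : ∫ x, (F t).osc (A t) (ρ t) u x ^ 2 ∂(F t).mu ≤
      3 * c_gap⁻¹ * s t ^ 2 * ∫ x, (F t).vertNorm x (du x) ^ 2 ∂(F t).mu := by
    refine key.trans_eq ?_
    rw [mul_inv, inv_inv]
    ring
  refine ⟨(hdis t).memLp_osc hB₀_open hu.memLp,
    TorusCollapse.TorusFibration.memLp_vertNorm hB₀_open (hsf t) (hε_nonneg t t.2) hu, key', ?_⟩
  calc c_gap / 3 * (s t ^ 2)⁻¹ * ∫ x, (F t).osc (A t) (ρ t) u x ^ 2 ∂(F t).mu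
      ≤ c_gap / 3 * (s t ^ 2)⁻¹ *
        (3 * c_gap⁻¹ * s t ^ 2 * ∫ x, (F t).vertNorm x (du x) ^ 2 ∂(F t).mu) := by gcongr
    _ = ∫ x, (F t).vertNorm x (du x) ^ 2 ∂(F t).mu := by field_simp
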